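/- **Setting.** Let $1\le n\le m$ and $1\le d\le m$ be integers. There are $n$ students and $m$ questions, $n+m$ subjects in all, and a vector $u\in\mathbb{R}^{n+m}$ of merits, normalised by $u_r=0$ at a reference subject $r$. Put $\alpha=\max_{a,b}(u_a-u_b)$ and $f(x)=1/(1+e^{-x})$. A random bipartite graph (the task assignment graph) is generated by assigning to each student, independently, a uniformly random set of $d$ distinct questions. Independently of the graph, the answers $w_{ij}$ ($i$ a student, $j$ a question) are independent Bernoulli variables with $\Pr[w_{ij}=1]=f(u_i-u_j)$. For a question $j$ assigned to student $i$, set $A'_{ij}=w_{ij}$ and $A'_{ji}=1-w_{ij}$; all other entries of the $(n+m)\times(n+m)$ matrix $A'$ are $0$. The maximum likelihood estimator $u^*$ is a maximiser over $v\in\mathbb{R}^{n+m}$ of $$\mathcal L(v)=\sum_{a\ne b}A'_{ab}\log f(v_a-v_b),$$ normalised by $u^*_r=0$. **Corollary (Rates).** Suppose $\alpha=O(1)$ and $d=\Omega\!\left(\frac{m\log^3(n+m)}{n}\right)$. Then, for all large $n$, with probability at least $1-2(n+m)^{-2}$ the estimator $u^*$ exists, is unique, and satisfies $$\|u^*-u\|_\infty=O\!\left(\frac{\log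 n}{\log\left(\frac nm d\right)}\sqrt{\frac{m\log(n+m)}{nd}}\right).$$ Explicitly: for every $A\in\mathbb{R}$ and every $c>0$ there are $C$ and $N$, depending only on $A$ and $c$, such that for all integers $n,m,d$ with $N\le n\le m$ and $c\,\frac{m\log^3(n+m)}{n}\le d\le m$, every reference subject $r$ and every $u\in\mathbb{R}^{n+m}$ with $u_r=0$ and $\alpha\le A$, with probability at least $1-2(n+m)^{-2}$ there is exactly one maximum likelihood estimator $u^*$ with $u^*_r=0$, and $$\|u^*-u\|_\infty\le C\,\frac{\log n}{\log\left(\frac nm d\right)}\sqrt{\frac{m\log(n+m)}{nd}}.$$ -/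

import Mathlib

noncomputable section

namespace RandomExam

/-- The subjects being compared: `n` students (left) and `m` questions (right). -/
abbrev Subject (n m : ℕ) : Type := Fin n ⊕ Fin m

/-- A task assignment graph: for each student, the set of assigned questions. -/
abbrev Assignment (n m : ℕ) : Type := Fin n → Finset (Fin m)

/-- The answers: `w (i, j) = true` means that student `i` answers question `j` correctly. -/
abbrev Answers (n m : ℕ) : Type := Fin n × Fin m → Bool

/-- The largest merit difference `α = max_{i,j} (u i - u j)`. -/
def meritSpread {n m : ℕ} (u : Subject n m → ℝ) : ℝ :=
  ⨆ p : Subject n m × Subject n m, (u p.1 - u p.2)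

/-- The law of the random bipartite graph: each student independently receives a uniformly random
set of `d` distinct questions. -/
def assignmentLaw (n m d : ℕ) : MeasureTheory.Measure (Assignment n m) :=
  MeasureTheory.Measure.pi fun _ : Fin n =>
    ProbabilityTheory.uniformOn {J : Finset (Fin m) | J.card = d}

/-- The law of the answers: independent, and `w (i, j)` is true with probability
`f (u_i - u_j) = 1 / (1 + exp (-(u_i - u_j)))`. -/
def answersLaw (n m : ℕ) (u : Subject n m → ℝ) : MeasureTheory.Measure (Answers n m) :=
  MeasureTheory.Measure.pi fun p : Fin n × Fin m =>
    ProbabilityTheory.bernoulliMeasure true false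
      (unitInterval.sigmoid (u (Sum.inl p.1) - u (Sum.inr p.2)))

/-- The joint law of the assignment and of the answers, which are independent of each other. -/
def examLaw (n m d : ℕ) (u : Subject n m → ℝ) :
    MeasureTheory.Measure (Assignment n m × Answers n m) :=
  (assignmentLaw n m d).prod (answersLaw n m u)

/-- The adjacency matrix `A'` of the exam result graph: `A' a b = 1` if `a` has beaten `b`.
A student beats an assigned question by answering it correctly, and is beaten by it otherwise. -/
def resultMatrix {n m : ℕ} (G : Assignment n m) (w : Answers n m) :
    Matrix (Subject n m) (Subject n m) ℝ
  | Sum.inl i, Sum.inr j => if j ∈ G i ∧ w (i, j) = true then 1 else 0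
  | Sum.inr j, Sum.inl i => if j ∈ G i ∧ w (i, j) = false then 1 else 0
  | Sum.inl _, Sum.inl _ => 0
  | Sum.inr _, Sum.inr _ => 0

/-- The log-likelihood `∑_{a ≠ b} A'_{a b} log f (v_a - v_b)` (the diagonal of `A'` is zero). -/
def logLikelihood {n m : ℕ} (G : Assignment n m) (w : Answers n m) (v : Subject n m → ℝ) : ℝ :=
  ∑ a, ∑ b, resultMatrix G w a b * Real.log (Real.sigmoid (v a - v b))

/-- `v` is a maximum likelihood estimator, normalised to vanish at the reference subject `r`. -/
def IsMLE {n m : ℕ} (G : Assignment n m) (w : Answers n m) (r : Subject n m)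
    (v : Subject n m → ℝ) : Prop :=
  v r = 0 ∧ ∀ v' : Subject n m → ℝ, logLikelihood G w v' ≤ logLikelihood G w v

end RandomExam

end

/-! Write `D = n d / m` for the mean number of students per question and `L = log (n + m)`. The
argument separates a deterministic statement about Bradley–Terry likelihoods from two concentration
estimates.

Deterministic part. At a maximiser `v` the expected wins of every subject equal its observed wins,
so the errors `v - u` are driven only by the noise, the residuals at `u`. Consider superlevel sets
of `v - u` at heights decreasing by a step `s`. Residuals are antisymmetric, so what crosses the
boundary of such a set equals the total noise in it, a small multiple of its volume. An edge
dropping a full step crosses with at least a fixed amount, so few edges skip a level: the sets form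
an `IsThickChain`. The sublevel sets form another. If the two chains meet after `T` steps, `v - u`
oscillates by at most `2 T s`, and it vanishes at `r`. The same meeting property forces Zermelo's
condition, hence existence and uniqueness (`exists_unique_maximiser_and_bound`).

Expansion. In an expanding graph the volume of a thick chain grows by a factor `D / (240 L)` per
step until the chain holds nine tenths of the students, so two chains meet
(`IsExpander.thickChains_meet`) within order `log n / log D` steps (`exists_steps`).

Probability. Chernoff bounds for sampling without replacement and a union bound over pairs of vertex
sets give expansion (`prob_not_isExpander_le`). Hoeffding's inequality bounds the noise relative to
the degree by a multiple of `√(L / D)` (`prob_noise_le`), which sets the size of `s`. -/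

noncomputable section

namespace RandomExam

open Finset MeasureTheory ProbabilityTheory

/-! ### Likelihood equations, existence and uniqueness of the maximiser. -/

section BradleyTerry

variable {V : Type*}

/-- Observed minus expected number of wins of `a` against `b` under the merits `v`. -/
def residual (B : V → V → ℝ) (v : V → ℝ) (a b : V) : ℝ :=
  B a b - (B a b + B b a) * Real.sigmoid (v a - v b)

lemma sigmoid_sub_swap (v : V → ℝ) (a b : V) :
    Real.sigmoid (v b - v a) = 1 - Real.sigmoid (v a - v b) := by
  rw [← Real.sigmoid_neg, neg_sub]

lemma residual_swap (B : V → V → ℝ) (v : V → ℝ) (a b : V) :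
    residual B v b a = -residual B v a b := by
  rw [residual, residual, sigmoid_sub_swap]
  ring

variable [Fintype V]

/-- The Bradley–Terry log-likelihood of the merits `v` given the result matrix `B`. -/
def btLogLik (B : V → V → ℝ) (v : V → ℝ) : ℝ :=
  ∑ a, ∑ b, B a b * Real.log (Real.sigmoid (v a - v b))

/-- Pairs inside `S` cancel, so a total over `S` is a flow through its boundary. -/
lemma sum_cut_of_antisymm [DecidableEq V] {H : V → V → ℝ} (hH : ∀ a b, H b a = -H a b)
    (S : Finset V) : ∑ a ∈ S, ∑ b, H a b = ∑ a ∈ S, ∑ b ∈ Sᶜ, H a b := by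
  have h0 : ∑ a ∈ S, ∑ b ∈ S, H a b = 0 := by
    have h1 : ∑ a ∈ S, ∑ b ∈ S, H a b = -∑ a ∈ S, ∑ b ∈ S, H a b := by
      conv_lhs => rw [Finset.sum_comm]
      simp only [← Finset.sum_neg_distrib]
      exact Finset.sum_congr rfl fun a _ => Finset.sum_congr rfl fun b _ => hH a b
    linarith
  calc ∑ a ∈ S, ∑ b, H a b = ∑ a ∈ S, (∑ b ∈ S, H a b + ∑ b ∈ Sᶜ, H a b) :=
        Finset.sum_congr rfl fun a _ => (Finset.sum_add_sum_compl S _).symm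
    _ = _ := by rw [Finset.sum_add_distrib, h0, zero_add]

lemma hasDerivAt_log_sigmoid (x : ℝ) :
    HasDerivAt (fun z => Real.log (Real.sigmoid z)) (1 - Real.sigmoid x) x := by
  have h := (Real.hasDerivAt_sigmoid x).log (Real.sigmoid_pos x).ne'
  convert h using 1
  have := (Real.sigmoid_pos x).ne'
  field_simp

lemma log_sigmoid_nonpos (x : ℝ) : Real.log (Real.sigmoid x) ≤ 0 :=
  Real.log_nonpos (Real.sigmoid_nonneg x) (Real.sigmoid_le_one x)

lemma log_sigmoid_le (x : ℝ) : Real.log (Real.sigmoid x) ≤ x := by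
  rw [Real.sigmoid_def, Real.log_inv]
  have h : Real.log (Real.exp (-x)) ≤ Real.log (1 + Real.exp (-x)) :=
    Real.log_le_log (Real.exp_pos _) (by linarith)
  rw [Real.log_exp] at h
  linarith

/-- The likelihood equations. -/
lemma sum_residual_eq_zero {B : V → V → ℝ} {v : V → ℝ}
    (hmax : ∀ v', btLogLik B v' ≤ btLogLik B v) (a : V) : ∑ b, residual B v a b = 0 := by
  classical
  let e : V → ℝ := Pi.single a 1
  have hd : HasDerivAt (fun t : ℝ => btLogLik B (v + t • e))
      (∑ i, ∑ j, B i j * ((1 - Real.sigmoid (v i - v j)) * (e i - e j))) 0 := by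
    unfold btLogLik
    refine HasDerivAt.fun_sum fun i _ => HasDerivAt.fun_sum fun j _ => ?_
    refine HasDerivAt.const_mul _ ?_
    have h1 : HasDerivAt (fun t : ℝ => (v + t • e) i - (v + t • e) j) (e i - e j) 0 := by
      have h2 : HasDerivAt (fun t : ℝ => (v i - v j) + t * (e i - e j)) (e i - e j) 0 := by
        simpa using ((hasDerivAt_id (0 : ℝ)).mul_const (e i - e j)).const_add (v i - v j)
      refine h2.congr_of_eventuallyEq (Filter.Eventually.of_forall fun t => ?_)
      simp only [Pi.add_apply, Pi.smul_apply, smul_eq_mul]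
      ring
    have h3 := hasDerivAt_log_sigmoid (v i - v j)
    have h4 : (v + (0 : ℝ) • e) i - (v + (0 : ℝ) • e) j = v i - v j := by simp
    rw [← h4] at h3
    have h5 := h3.comp (0 : ℝ) h1
    rw [h4] at h5
    exact h5
  have hz := IsLocalMax.hasDerivAt_eq_zero
    (Filter.Eventually.of_forall fun t => by simpa using hmax (v + t • e)) hd
  rw [← hz]
  have h1 : ∑ i, ∑ j, B i j * ((1 - Real.sigmoid (v i - v j)) * (e i - e j)) =
      ∑ i, ∑ j, B i j * (1 - Real.sigmoid (v i - v j)) * e i -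
        ∑ j, ∑ i, B i j * (1 - Real.sigmoid (v i - v j)) * e j := by
    rw [Finset.sum_comm (s := univ) (t := univ)
      (f := fun j i => B i j * (1 - Real.sigmoid (v i - v j)) * e j), ← Finset.sum_sub_distrib]
    refine Finset.sum_congr rfl fun i _ => ?_
    rw [← Finset.sum_sub_distrib]
    exact Finset.sum_congr rfl fun j _ => by ring
  rw [h1]
  simp only [← Finset.sum_mul]
  simp only [e, Pi.single_apply, mul_ite, mul_one, mul_zero, Finset.sum_ite_eq', Finset.mem_univ,
    if_true]
  rw [← Finset.sum_sub_distrib]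
  refine Finset.sum_congr rfl fun b _ => ?_
  rw [residual, sigmoid_sub_swap v a b]
  ring

/-- Zermelo's connectivity condition: for every cut, someone outside has beaten someone inside. -/
def CutConnected (B : V → V → ℝ) : Prop :=
  ∀ S : Finset V, S.Nonempty → S ≠ univ → ∃ a ∉ S, ∃ b ∈ S, 1 ≤ B a b

lemma btLogLik_sub_const (B : V → V → ℝ) (v : V → ℝ) (c : ℝ) :
    btLogLik B (fun a => v a - c) = btLogLik B v := by
  simp [btLogLik]

lemma continuous_btLogLik (B : V → V → ℝ) : Continuous (btLogLik B) := by
  unfold btLogLik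
  refine continuous_finsetSum _ fun a _ => continuous_finsetSum _ fun b _ => ?_
  refine continuous_const.mul (Continuous.log ?_ fun v => (Real.sigmoid_pos _).ne')
  exact continuous_sigmoid.comp (by fun_prop)

/-- All terms are nonpositive, so the sum is at most any single one. Hence a lower bound on the
likelihood limits how far a winner can lie below a loser. -/
lemma btLogLik_le_sub {B : V → V → ℝ} (hB : ∀ a b, 0 ≤ B a b) (v : V → ℝ) {a b : V}
    (hab : 1 ≤ B a b) : btLogLik B v ≤ v a - v b := by
  have hn : ∀ i j, B i j * Real.log (Real.sigmoid (v i - v j)) ≤ 0 := fun i j =>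
    mul_nonpos_of_nonneg_of_nonpos (hB i j) (log_sigmoid_nonpos _)
  have h1 : btLogLik B v ≤ ∑ j, B a j * Real.log (Real.sigmoid (v a - v j)) := by
    have := Finset.single_le_sum (s := univ)
      (f := fun i => -∑ j, B i j * Real.log (Real.sigmoid (v i - v j)))
      (fun i _ => neg_nonneg.2 (Finset.sum_nonpos fun j _ => hn i j)) (Finset.mem_univ a)
    rw [Finset.sum_neg_distrib] at this
    exact neg_le_neg_iff.1 this
  have h2 : ∑ j, B a j * Real.log (Real.sigmoid (v a - v j)) ≤
      B a b * Real.log (Real.sigmoid (v a - v b)) := by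
    have := Finset.single_le_sum (s := univ)
      (f := fun j => -(B a j * Real.log (Real.sigmoid (v a - v j))))
      (fun j _ => neg_nonneg.2 (hn a j)) (Finset.mem_univ b)
    rw [Finset.sum_neg_distrib] at this
    exact neg_le_neg_iff.1 this
  have h3 : B a b * Real.log (Real.sigmoid (v a - v b)) ≤ Real.log (Real.sigmoid (v a - v b)) := by
    nlinarith [log_sigmoid_nonpos (v a - v b)]
  linarith [log_sigmoid_le (v a - v b)]

lemma sub_le_of_cutConnected {B : V → V → ℝ} (hF : CutConnected B) {v : V → ℝ} {K : ℝ}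
    (hK : 0 ≤ K) (hv : ∀ a b, 1 ≤ B a b → v b - v a ≤ K) (a b : V) :
    v a - v b ≤ Fintype.card V * K := by
  classical
  -- By `CutConnected`, each superlevel set that is not everything is entered by a new vertex when
  -- the level drops by `K`.
  have key : ∀ t : ℕ, t + 1 ≤ (univ.filter fun i => v a - t * K ≤ v i).card ∨
      (univ.filter fun i => v a - t * K ≤ v i) = univ := by
    intro t
    induction t with
    | zero => exact Or.inl (Finset.card_pos.2 ⟨a, by simp⟩)
    | succ t ih =>
      have hsub : (univ.filter fun i => v a - t * K ≤ v i) ⊆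
          univ.filter fun i => v a - (t + 1 : ℕ) * K ≤ v i := by
        intro i hi
        simp only [mem_filter, mem_univ, true_and] at hi ⊢
        push_cast
        linarith
      rcases ih with ih | ih
      · by_cases hu : (univ.filter fun i => v a - t * K ≤ v i) = univ
        · exact Or.inr (Finset.univ_subset_iff.1 (hu.symm.subset.trans hsub))
        · obtain ⟨x, hx, y, hy, hxy⟩ := hF _ (Finset.card_pos.1 (by omega)) hu
          left
          have : (univ.filter fun i => v a - t * K ≤ v i) ⊂
              univ.filter fun i => v a - (t + 1 : ℕ) * K ≤ v i := by
            refine Finset.ssubset_iff_subset_ne.2 ⟨hsub, fun h => hx ?_⟩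
            rw [h]
            simp only [mem_filter, mem_univ, true_and] at hy ⊢
            push_cast
            linarith [hv x y hxy]
          have := Finset.card_lt_card this
          omega
      · exact Or.inr (Finset.univ_subset_iff.1 (ih.symm.subset.trans hsub))
  have hu : (univ.filter fun i => v a - (Fintype.card V : ℕ) * K ≤ v i) = univ := by
    rcases key (Fintype.card V) with h | h
    · exact absurd (h.trans (Finset.card_le_univ _)) (by simp)
    · exact h
  have : b ∈ univ.filter fun i => v a - (Fintype.card V : ℕ) * K ≤ v i := by
    rw [hu]; exact mem_univ b
  simp only [mem_filter, mem_univ, true_and] at this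
  linarith

/-- Merits at least as likely as `0` have spread at most `R` by connectivity, so after normalising
at `r` the maximum over a compact box is global. -/
lemma exists_maximiser {B : V → V → ℝ} (hB : ∀ a b, 0 ≤ B a b) (hF : CutConnected B) (r : V) :
    ∃ v : V → ℝ, v r = 0 ∧ ∀ v', btLogLik B v' ≤ btLogLik B v := by
  have hK : 0 ≤ -btLogLik B 0 := by
    rw [btLogLik, neg_nonneg]
    exact Finset.sum_nonpos fun a _ => Finset.sum_nonpos fun b _ =>
      mul_nonpos_of_nonneg_of_nonpos (hB a b) (log_sigmoid_nonpos _)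
  set R : ℝ := Fintype.card V * -btLogLik B 0 with hR
  have hR0 : 0 ≤ R := by positivity
  let s : Set (V → ℝ) := Set.Icc (fun _ => -R) (fun _ => R) ∩ {v | v r = 0}
  have hs : IsCompact s := isCompact_Icc.inter_right
    (isClosed_eq (continuous_apply r) continuous_const)
  have h0s : (0 : V → ℝ) ∈ s := ⟨⟨fun _ => by simpa, fun _ => by simpa⟩, rfl⟩
  obtain ⟨v, hvs, hv⟩ := hs.exists_isMaxOn ⟨0, h0s⟩ (continuous_btLogLik B).continuousOn
  refine ⟨v, hvs.2, fun v' => ?_⟩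
  rcases le_total (btLogLik B v') (btLogLik B 0) with h | h
  · exact h.trans (hv h0s)
  · rw [← btLogLik_sub_const B v' (v' r)]
    refine hv ⟨?_, by simp⟩
    have hb := sub_le_of_cutConnected hF hK (v := v') fun a b hab => by
      linarith [btLogLik_le_sub hB v' hab]
    exact ⟨fun a => by
      change -R ≤ v' a - v' r
      linarith [hb r a], fun a => hb a r⟩

/-- On the set where `v - v'` is largest the two likelihood equations make the boundary flow zero,
while strict monotonicity of the sigmoid makes it negative unless the set is everything. -/
lemma eq_of_sum_residual_eq_zero {B : V → V → ℝ} (hB : ∀ a b, 0 ≤ B a b) (hF : CutConnected B)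
    {r : V} {v v' : V → ℝ} (hr : v r = v' r) (hv : ∀ a, ∑ b, residual B v a b = 0)
    (hv' : ∀ a, ∑ b, residual B v' a b = 0) : v = v' := by
  classical
  obtain ⟨c, -, hc⟩ := Finset.exists_max_image univ (fun a => v a - v' a) ⟨r, mem_univ r⟩
  let S := univ.filter fun a => v a - v' a = v c - v' c
  have hSu : S = univ := by
    by_contra hne
    obtain ⟨a, ha, b, hb, hab⟩ := hF S ⟨c, by simp [S]⟩ hne
    have hanti : ∀ i j, residual B v j i - residual B v' j i =
        -(residual B v i j - residual B v' i j) := fun i j => by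
      rw [residual_swap, residual_swap B v']; ring
    have h0 := sum_cut_of_antisymm hanti S
    rw [Finset.sum_eq_zero fun i _ => by rw [Finset.sum_sub_distrib, hv, hv', sub_zero]] at h0
    have hle : ∀ i ∈ S, ∀ j ∈ Sᶜ, residual B v i j - residual B v' i j ≤ 0 := by
      intro i hi j _
      simp only [S, mem_filter, mem_univ, true_and] at hi
      have hE : 0 ≤ B i j + B j i := add_nonneg (hB _ _) (hB _ _)
      have hs : Real.sigmoid (v' i - v' j) ≤ Real.sigmoid (v i - v j) :=
        Real.sigmoid_le (by linarith [hc j (mem_univ j)])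
      unfold residual
      nlinarith
    have hlt : ∑ i ∈ S, ∑ j ∈ Sᶜ, (residual B v i j - residual B v' i j) < 0 := by
      refine Finset.sum_neg' (fun i hi => Finset.sum_nonpos (hle i hi)) ⟨b, hb, ?_⟩
      refine Finset.sum_neg' (hle b hb) ⟨a, by simpa using ha, ?_⟩
      simp only [S, mem_filter, mem_univ, true_and] at hb ha
      have hE : 0 < B b a + B a b := by linarith [hB b a]
      have hs : Real.sigmoid (v' b - v' a) < Real.sigmoid (v b - v a) :=
        Real.sigmoid_lt (by linarith [lt_of_le_of_ne (hc a (mem_univ a)) ha])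
      unfold residual
      nlinarith
    linarith
  have hall : ∀ a, v a - v' a = v c - v' c := fun a => by
    have : a ∈ S := hSu ▸ mem_univ a
    simpa [S] using this
  funext a
  linarith [hall a, hall r]

/-! ### Thick chains and the deterministic error bound. -/

/-- The total weight of the pairs in `S × S'`. -/
def cutWeight (E : V → V → ℝ) (S S' : Finset V) : ℝ := ∑ a ∈ S, ∑ b ∈ S', E a b

/-- The flow out of `S` is at most `η` times its volume. Every boundary edge contributes a
nonnegative amount, and each edge that also leaves `S'` contributes at least `κ` per unit weight. -/
lemma cutWeight_threshold [DecidableEq V] {E : V → V → ℝ} (hE : ∀ a b, 0 ≤ E a b)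
    (hsymm : ∀ a b, E a b = E b a) {x y : V → ℝ} {η κ s : ℝ}
    (hη : ∀ a, ∑ b, E a b * (Real.sigmoid (x a - x b) - Real.sigmoid (y a - y b)) ≤
      η * ∑ b, E a b)
    (hκ : ∀ a b, κ ≤ Real.sigmoid (y a - y b + s) - Real.sigmoid (y a - y b))
    {S S' : Finset V} (hSS' : S ⊆ S')
    (hS : ∀ a ∈ S, ∀ b ∉ S, x b - y b ≤ x a - y a)
    (hS' : ∀ a ∈ S, ∀ b ∉ S', x b - y b + s ≤ x a - y a) :
    κ * cutWeight E S S'ᶜ ≤ η * cutWeight E S univ := by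
  have hanti : ∀ a b, E b a * (Real.sigmoid (x b - x a) - Real.sigmoid (y b - y a)) =
      -(E a b * (Real.sigmoid (x a - x b) - Real.sigmoid (y a - y b))) := fun a b => by
    rw [hsymm b a, sigmoid_sub_swap x, sigmoid_sub_swap y]; ring
  calc κ * cutWeight E S S'ᶜ = ∑ a ∈ S, ∑ b ∈ S'ᶜ, E a b * κ := by
        rw [cutWeight, Finset.mul_sum]
        refine Finset.sum_congr rfl fun a _ => ?_
        rw [Finset.mul_sum]
        exact Finset.sum_congr rfl fun b _ => mul_comm _ _
    _ ≤ ∑ a ∈ S, ∑ b ∈ S'ᶜ, E a b * (Real.sigmoid (x a - x b) - Real.sigmoid (y a - y b)) := by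
        refine Finset.sum_le_sum fun a ha => Finset.sum_le_sum fun b hb => ?_
        refine mul_le_mul_of_nonneg_left ((hκ a b).trans ?_) (hE a b)
        have := hS' a ha b (by simpa using hb)
        exact sub_le_sub_right (Real.sigmoid_le (by linarith)) _
    _ ≤ ∑ a ∈ S, ∑ b ∈ Sᶜ, E a b * (Real.sigmoid (x a - x b) - Real.sigmoid (y a - y b)) := by
        refine Finset.sum_le_sum fun a ha => Finset.sum_le_sum_of_subset_of_nonneg
          (Finset.compl_subset_compl.2 hSS') fun b hb _ => mul_nonneg (hE a b) ?_
        have := hS a ha b (by simpa using hb)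
        exact sub_nonneg.2 (Real.sigmoid_le (by linarith))
    _ = ∑ a ∈ S, ∑ b, E a b * (Real.sigmoid (x a - x b) - Real.sigmoid (y a - y b)) :=
        (sum_cut_of_antisymm hanti S).symm
    _ ≤ ∑ a ∈ S, η * ∑ b, E a b := Finset.sum_le_sum fun a _ => hη a
    _ = η * cutWeight E S univ := by rw [cutWeight, Finset.mul_sum]

/-- A monotone chain of vertex sets in which few edges of each set leave the next one. -/
structure IsThickChain (E : V → V → ℝ) (ε : ℝ) (S : ℕ → Finset V) : Prop where
  mono : Monotone S
  nonempty : (S 0).Nonempty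
  cut_le : ∀ t (S' : Finset V), (∀ a, a ∈ S' ↔ a ∉ S (t + 1)) →
    cutWeight E (S t) S' ≤ ε * cutWeight E (S t) univ

lemma isThickChain_threshold {E : V → V → ℝ} (hE : ∀ a b, 0 ≤ E a b)
    (hsymm : ∀ a b, E a b = E b a) {x y : V → ℝ} {η κ s ε : ℝ} (hs : 0 ≤ s) (hκ0 : 0 < κ)
    (hηε : η ≤ ε * κ)
    (hη : ∀ a, ∑ b, E a b * (Real.sigmoid (x a - x b) - Real.sigmoid (y a - y b)) ≤
      η * ∑ b, E a b)
    (hκ : ∀ a b, κ ≤ Real.sigmoid (y a - y b + s) - Real.sigmoid (y a - y b))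
    (c : V) :
    IsThickChain E ε fun t => univ.filter fun a => x c - y c - t * s ≤ x a - y a where
  mono := by
    intro t t' htt' a ha
    simp only [mem_filter, mem_univ, true_and] at ha ⊢
    have : (t : ℝ) ≤ t' := by exact_mod_cast htt'
    nlinarith
  nonempty := ⟨c, by simp⟩
  cut_le := by
    classical
    intro t S' hS'
    obtain rfl : S' = (univ.filter fun a => x c - y c - (t + 1 : ℕ) * s ≤ x a - y a)ᶜ := by
      ext a; rw [hS', mem_compl]
    have h := cutWeight_threshold hE hsymm hη hκ
      (S := univ.filter fun a => x c - y c - t * s ≤ x a - y a)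
      (S' := univ.filter fun a => x c - y c - (t + 1 : ℕ) * s ≤ x a - y a) ?_ ?_ ?_
    · have hvol : 0 ≤ cutWeight E (univ.filter fun a => x c - y c - t * s ≤ x a - y a) univ :=
        Finset.sum_nonneg fun a _ => Finset.sum_nonneg fun b _ => hE a b
      refine le_of_mul_le_mul_left (h.trans ?_) hκ0
      calc _ ≤ ε * κ * _ := mul_le_mul_of_nonneg_right hηε hvol
        _ = _ := by ring
    · intro a ha
      simp only [mem_filter, mem_univ, true_and] at ha ⊢
      push_cast
      linarith
    · intro a ha b hb
      simp only [mem_filter, mem_univ, true_and] at ha hb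
      linarith
    · intro a ha b hb
      simp only [mem_filter, mem_univ, true_and] at ha hb
      push_cast at hb
      linarith

/-- If nobody outside `S` beats anybody inside, each game across the cut has residual at least `κ`,
so small noise leaves few edges across it. Then the constant chains `S` and `Sᶜ` are both thick, yet
disjoint. -/
lemma cutConnected_of_isThickChain {B : V → V → ℝ} (hB : ∀ a b, B a b = 0 ∨ 1 ≤ B a b) {u : V → ℝ}
    {η κ ε : ℝ} (hκ0 : 0 < κ) (hηε : η ≤ ε * κ)
    (hη : ∀ a, |∑ b, residual B u a b| ≤ η * ∑ b, (B a b + B b a))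
    (hκ : ∀ a b, κ ≤ Real.sigmoid (u a - u b))
    {T : ℕ} (hmeet : ∀ S S' : ℕ → Finset V, IsThickChain (fun a b => B a b + B b a) ε S →
      IsThickChain (fun a b => B a b + B b a) ε S' → ∃ a, a ∈ S T ∧ a ∈ S' T) :
    CutConnected B := by
  classical
  intro S hS hSu
  by_contra hcon
  push Not at hcon
  have hzero : ∀ a ∉ S, ∀ b ∈ S, B a b = 0 := fun a ha b hb =>
    (hB a b).resolve_right (not_le.2 (hcon a ha b hb))
  have hE : ∀ a b, 0 ≤ B a b + B b a := fun a b => by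
    rcases hB a b with h | h <;> rcases hB b a with h' | h' <;> linarith
  have hηS : ∀ R : Finset V, |∑ a ∈ R, ∑ b, residual B u a b| ≤
      η * cutWeight (fun a b => B a b + B b a) R univ := fun R => by
    rw [cutWeight, Finset.mul_sum]
    exact (Finset.abs_sum_le_sum_abs _ _).trans (Finset.sum_le_sum fun a _ => hη a)
  have hlow : κ * cutWeight (fun a b => B a b + B b a) S Sᶜ ≤
      ∑ a ∈ S, ∑ b ∈ Sᶜ, residual B u a b := by
    rw [cutWeight, Finset.mul_sum]
    refine Finset.sum_le_sum fun a ha => ?_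
    rw [Finset.mul_sum]
    refine Finset.sum_le_sum fun b hb => ?_
    have h0 := hzero b (by simpa using hb) a ha
    have h1 := hκ b a
    rw [sigmoid_sub_swap] at h1
    have := hE a b
    rw [residual, h0] at *
    nlinarith
  have hvol : ∀ R : Finset V, 0 ≤ cutWeight (fun a b => B a b + B b a) R univ := fun R =>
    Finset.sum_nonneg fun a _ => Finset.sum_nonneg fun b _ => hE a b
  have hfin : ∀ R : Finset V, κ * cutWeight (fun a b => B a b + B b a) R Rᶜ ≤
      |∑ a ∈ R, ∑ b, residual B u a b| → R.Nonempty →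
      IsThickChain (fun a b => B a b + B b a) ε fun _ => R := fun R hR hne =>
    { mono := monotone_const
      nonempty := hne
      cut_le := fun t S' hS' => by
        obtain rfl : S' = Rᶜ := by ext a; rw [hS', mem_compl]
        refine le_of_mul_le_mul_left ((hR.trans (hηS R)).trans ?_) hκ0
        calc _ ≤ ε * κ * _ := mul_le_mul_of_nonneg_right hηε (hvol R)
          _ = _ := by ring }
  have hcut := sum_cut_of_antisymm (residual_swap B u) S
  have hcut' := sum_cut_of_antisymm (residual_swap B u) Sᶜ
  have hsw : ∑ a ∈ Sᶜ, ∑ b ∈ Sᶜᶜ, residual B u a b = -∑ a ∈ S, ∑ b ∈ Sᶜ, residual B u a b := by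
    rw [compl_compl, Finset.sum_comm]
    simp only [← Finset.sum_neg_distrib]
    exact Finset.sum_congr rfl fun a _ => Finset.sum_congr rfl fun b _ => residual_swap B u a b
  have hsw' : cutWeight (fun a b => B a b + B b a) Sᶜ Sᶜᶜ =
      cutWeight (fun a b => B a b + B b a) S Sᶜ := by
    rw [compl_compl, cutWeight, cutWeight, Finset.sum_comm]
    exact Finset.sum_congr rfl fun a _ => Finset.sum_congr rfl fun b _ => add_comm _ _
  obtain ⟨a, ha, ha'⟩ := hmeet _ _ (hfin S (hlow.trans (hcut ▸ le_abs_self _)) hS)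
    (hfin Sᶜ (by
      rw [hsw', hcut', hsw, abs_neg]
      exact hlow.trans (le_abs_self _))
      (Finset.nonempty_iff_ne_empty.2 fun h => hSu (by simpa using h)))
  simp only [mem_compl] at ha'
  exact ha' ha

/-- If any two thick chains meet after `T` steps and the noise is small compared with the degrees,
then the maximum likelihood estimator exists, is unique and is close to the truth. -/
theorem exists_unique_maximiser_and_bound {B : V → V → ℝ} (hB : ∀ a b, B a b = 0 ∨ 1 ≤ B a b)
    {u : V → ℝ} {r : V} (hur : u r = 0) {η κ s ε : ℝ} (hs0 : 0 ≤ s) (hκ0 : 0 < κ)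
    (hηε : η ≤ ε * κ)
    (hη : ∀ a, |∑ b, residual B u a b| ≤ η * ∑ b, (B a b + B b a))
    (hκ : ∀ a b, κ ≤ Real.sigmoid (u a - u b + s) - Real.sigmoid (u a - u b))
    (hκ' : ∀ a b, κ ≤ Real.sigmoid (u a - u b))
    {T : ℕ} (hmeet : ∀ S S' : ℕ → Finset V, IsThickChain (fun a b => B a b + B b a) ε S →
      IsThickChain (fun a b => B a b + B b a) ε S' → ∃ a, a ∈ S T ∧ a ∈ S' T) :
    (∃! v : V → ℝ, v r = 0 ∧ ∀ v', btLogLik B v' ≤ btLogLik B v) ∧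
      ∀ v : V → ℝ, (v r = 0 ∧ ∀ v', btLogLik B v' ≤ btLogLik B v) → ‖v - u‖ ≤ 2 * T * s := by
  have hB0 : ∀ a b, 0 ≤ B a b := fun a b => by rcases hB a b with h | h <;> linarith
  have hF := cutConnected_of_isThickChain hB hκ0 hηε hη hκ' hmeet
  obtain ⟨v, hvr, hv⟩ := exists_maximiser hB0 hF r
  refine ⟨⟨v, ⟨hvr, hv⟩, fun v' hv' => eq_of_sum_residual_eq_zero hB0 hF (hv'.1.trans hvr.symm)
    (sum_residual_eq_zero hv'.2) (sum_residual_eq_zero hv)⟩, ?_⟩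
  rintro w ⟨hwr, hw⟩
  have hsum : ∀ a, ∑ b, (B a b + B b a) * (Real.sigmoid (w a - w b) - Real.sigmoid (u a - u b)) =
      ∑ b, residual B u a b := fun a => by
    have h0 := sum_residual_eq_zero hw a
    rw [← sub_zero (∑ b, residual B u a b), ← h0, ← Finset.sum_sub_distrib]
    exact Finset.sum_congr rfl fun b _ => by unfold residual; ring
  have hE : ∀ a b, 0 ≤ B a b + B b a := fun a b => add_nonneg (hB0 _ _) (hB0 _ _)
  have hsymm : ∀ a b, B a b + B b a = B b a + B a b := fun a b => add_comm _ _
  obtain ⟨c, -, hc⟩ := Finset.exists_max_image univ (fun a => w a - u a) ⟨r, mem_univ r⟩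
  -- Changing all signs turns the minimum of `w - u` into a maximum, and yields the second chain.
  obtain ⟨c', -, hc'⟩ := Finset.exists_max_image univ (fun a => -w a - -u a) ⟨r, mem_univ r⟩
  have h1 := isThickChain_threshold (E := fun a b => B a b + B b a) hE hsymm hs0 hκ0 hηε
    (fun a => by rw [hsum]; exact (le_abs_self _).trans (hη a)) hκ c
  have h2 := isThickChain_threshold (E := fun a b => B a b + B b a) hE hsymm hs0 hκ0 hηε
    (x := fun a => -w a) (y := fun a => -u a)
    (fun a => by
      refine le_trans (le_of_eq ?_) ((neg_le_abs _).trans (hη a))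
      rw [← hsum, ← Finset.sum_neg_distrib]
      refine Finset.sum_congr rfl fun b _ => ?_
      rw [show -w a - -w b = w b - w a by ring, show -u a - -u b = u b - u a by ring,
        sigmoid_sub_swap w, sigmoid_sub_swap u]
      ring)
    (fun a b => by rw [show -u a - -u b = u b - u a by ring]; exact hκ b a)
    c'
  -- At `a` the error is within `T * s` of both its maximum and its minimum. As the error is `0` at
  -- `r`, these extremes have opposite signs.
  obtain ⟨a, ha, ha'⟩ := hmeet _ _ h1 h2
  simp only [mem_filter, mem_univ, true_and] at ha ha'
  have hr1 := hc r (mem_univ r)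
  have hr2 := hc' r (mem_univ r)
  simp only [hwr, hur] at hr1 hr2
  refine (pi_norm_le_iff_of_nonneg (by positivity)).2 fun b => ?_
  have hb1 := hc b (mem_univ b)
  have hb2 := hc' b (mem_univ b)
  rw [Pi.sub_apply, Real.norm_eq_abs, abs_le]
  constructor <;> linarith

/-- Mean value inequality: the derivative is `σ(w) σ(-w)`, and `|w| ≤ A + 1` on the interval because
`s ≤ 1`. -/
lemma sigmoid_add_sub_ge {A z s : ℝ} (hz : |z| ≤ A) (hs0 : 0 ≤ s) (hs1 : s ≤ 1) :
    Real.sigmoid (-(A + 1)) ^ 2 * s ≤ Real.sigmoid (z + s) - Real.sigmoid z := by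
  have h := (convex_Icc z (z + s)).mul_sub_le_image_sub_of_le_deriv
    (f := Real.sigmoid) (C := Real.sigmoid (-(A + 1)) ^ 2) continuous_sigmoid.continuousOn
    differentiable_sigmoid.differentiableOn ?_ z ⟨le_rfl, by linarith⟩ (z + s)
    ⟨by linarith, le_rfl⟩ (by linarith)
  · simpa using h
  · intro w hw
    rw [interior_Icc] at hw
    rw [Real.deriv_sigmoid]
    beta_reduce
    rw [← Real.sigmoid_neg, sq]
    obtain ⟨h1, h2⟩ := abs_le.1 hz
    exact mul_le_mul (Real.sigmoid_le (by linarith [hw.1])) (Real.sigmoid_le (by linarith [hw.2]))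
      (Real.sigmoid_nonneg _) (Real.sigmoid_nonneg _)

end BradleyTerry

/-! ### Growth of thick chains in expanding bipartite graphs. -/

section Expander

variable {n m : ℕ}

/-- The number of assigned pairs in `X × Y`. -/
def edgeCount (G : Assignment n m) (X : Finset (Fin n)) (Y : Finset (Fin m)) : ℝ :=
  ∑ i ∈ X, ((G i ∩ Y).card : ℝ)

/-- Weight of a pair of subjects in the task assignment graph. -/
def resultWeight (G : Assignment n m) (w : Answers n m) (a b : Subject n m) : ℝ :=
  resultMatrix G w a b + resultMatrix G w b a

lemma resultWeight_inl_inr (G : Assignment n m) (w : Answers n m) (i : Fin n) (j : Fin m) :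
    resultWeight G w (Sum.inl i) (Sum.inr j) = if j ∈ G i then 1 else 0 := by
  by_cases h : j ∈ G i <;> cases hw : w (i, j) <;> simp [resultWeight, resultMatrix, h, hw]

lemma resultWeight_inr_inl (G : Assignment n m) (w : Answers n m) (i : Fin n) (j : Fin m) :
    resultWeight G w (Sum.inr j) (Sum.inl i) = if j ∈ G i then 1 else 0 := by
  rw [← resultWeight_inl_inr G w, resultWeight, resultWeight, add_comm]

lemma resultWeight_inl_inl (G : Assignment n m) (w : Answers n m) (i i' : Fin n) :
    resultWeight G w (Sum.inl i) (Sum.inl i') = 0 := by simp [resultWeight, resultMatrix]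

lemma resultWeight_inr_inr (G : Assignment n m) (w : Answers n m) (j j' : Fin m) :
    resultWeight G w (Sum.inr j) (Sum.inr j') = 0 := by simp [resultWeight, resultMatrix]

lemma card_inter_eq_sum (s t : Finset (Fin m)) :
    ((s ∩ t).card : ℝ) = ∑ j ∈ t, if j ∈ s then (1 : ℝ) else 0 := by
  rw [Finset.sum_ite_mem, Finset.inter_comm]; simp

lemma cutWeight_resultWeight (G : Assignment n m) (w : Answers n m) (S S' : Finset (Subject n m)) :
    cutWeight (resultWeight G w) S S' =
      edgeCount G S.toLeft S'.toRight + edgeCount G S'.toLeft S.toRight := by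
  rw [cutWeight, Finset.sum_sum_eq_sum_toLeft_add_sum_toRight]
  congr 1
  · refine Finset.sum_congr rfl fun i _ => ?_
    simp [Finset.sum_sum_eq_sum_toLeft_add_sum_toRight S', resultWeight_inl_inl, resultWeight_inl_inr,
      card_inter_eq_sum]
  · rw [edgeCount]
    simp only [card_inter_eq_sum]
    refine Finset.sum_comm.trans (Finset.sum_congr rfl fun j _ => ?_) |>.symm
    simp [Finset.sum_sum_eq_sum_toLeft_add_sum_toRight S', resultWeight_inr_inr, resultWeight_inr_inl]

lemma edgeCount_nonneg (G : Assignment n m) (X : Finset (Fin n)) (Y : Finset (Fin m)) :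
    0 ≤ edgeCount G X Y := Finset.sum_nonneg fun _ _ => Nat.cast_nonneg _

lemma edgeCount_mono (G : Assignment n m) {X X' : Finset (Fin n)} {Y Y' : Finset (Fin m)}
    (hX : X ⊆ X') (hY : Y ⊆ Y') : edgeCount G X Y ≤ edgeCount G X' Y' := by
  refine (Finset.sum_le_sum fun i _ => ?_).trans
    (Finset.sum_le_sum_of_subset_of_nonneg hX fun _ _ _ => Nat.cast_nonneg _)
  exact_mod_cast Finset.card_le_card (Finset.inter_subset_inter_left hY)

lemma edgeCount_univ_left (G : Assignment n m) (Y : Finset (Fin m)) :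
    edgeCount G univ Y = ∑ j ∈ Y, edgeCount G univ {j} := by
  simp only [edgeCount]
  rw [Finset.sum_comm]
  exact Finset.sum_congr rfl fun i _ => by simp only [card_inter_eq_sum, sum_singleton]

/-- Regularity and expansion of a task assignment graph in which each student has `d` questions
and each question about `D` students. -/
structure IsExpander (G : Assignment n m) (d : ℕ) (D L : ℝ) : Prop where
  card : ∀ i, (G i).card = d
  deg_ge : ∀ j, D / 2 ≤ edgeCount G univ {j}
  deg_le : ∀ j, edgeCount G univ {j} ≤ 3 * D
  left : ∀ X Y, X.Nonempty → (Y.card : ℝ) < 0.9 * m → (Y.card : ℝ) < d * X.card / (40 * L) →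
    0.01 * (d * X.card) < edgeCount G X Yᶜ
  right : ∀ X Y, Y.Nonempty → (X.card : ℝ) < 0.9 * n → (X.card : ℝ) < D * Y.card / (40 * L) →
    0.01 * edgeCount G univ Y < edgeCount G Xᶜ Y

variable {G : Assignment n m} {w : Answers n m} {d : ℕ} {D L : ℝ}

namespace IsExpander

lemma edgeCount_univ_right (h : IsExpander G d D L) (X : Finset (Fin n)) :
    edgeCount G X univ = d * X.card := by
  simp [edgeCount, h.card, mul_comm]

lemma edgeCount_ge (h : IsExpander G d D L) (Y : Finset (Fin m)) :
    D / 2 * Y.card ≤ edgeCount G univ Y := by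
  rw [edgeCount_univ_left, mul_comm, ← nsmul_eq_mul]
  exact Finset.card_nsmul_le_sum _ _ _ fun j _ => h.deg_ge j

lemma edgeCount_le (h : IsExpander G d D L) (Y : Finset (Fin m)) :
    edgeCount G univ Y ≤ 3 * D * Y.card := by
  rw [edgeCount_univ_left, mul_comm _ (Y.card : ℝ), ← nsmul_eq_mul]
  exact Finset.sum_le_card_nsmul _ _ _ fun j _ => h.deg_le j

lemma vol_eq (h : IsExpander G d D L) (S : Finset (Subject n m)) :
    cutWeight (resultWeight G w) S univ = d * S.toLeft.card + edgeCount G univ S.toRight := by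
  rw [cutWeight_resultWeight, ← h.edgeCount_univ_right]
  simp

lemma vol_le (h : IsExpander G d D L) (S : Finset (Subject n m)) :
    cutWeight (resultWeight G w) S univ ≤ 2 * (n * d) := by
  rw [h.vol_eq]
  have h1 : edgeCount G univ S.toRight ≤ d * n := by
    refine (edgeCount_mono G (Finset.Subset.refl _) (Finset.subset_univ _)).trans ?_
    rw [h.edgeCount_univ_right]; simp
  have h2 : (d : ℝ) * S.toLeft.card ≤ d * n := by
    gcongr
    exact_mod_cast card_finset_fin_le _
  linarith

lemma cut_bounds {S : ℕ → Finset (Subject n m)}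
    (hS : IsThickChain (resultWeight G w) (1 / 500) S) (t : ℕ) :
    edgeCount G (S t).toLeft (S (t + 1)).toRightᶜ + edgeCount G (S (t + 1)).toLeftᶜ (S t).toRight ≤
      1 / 500 * cutWeight (resultWeight G w) (S t) univ := by
  have h1 := hS.cut_le t (S (t + 1))ᶜ fun a => mem_compl
  rw [cutWeight_resultWeight] at h1
  convert h1 using 3 <;> ext a <;> simp

/-- Otherwise more than `0.01 * (D / 2) * 0.9 m = 0.0045 n d` edges would leave, while thickness
allows at most `2 n d / 500`. Since `40 L ≤ D` and `n ≤ m`, the second size condition of `right` is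
automatic. -/
lemma right_saturated (h : IsExpander G d D L) (hm : 0 < m) (hnm : n ≤ m) (hL : 0 < L)
    (hDL : 40 * L ≤ D) (hD : D * m = n * d) {S : ℕ → Finset (Subject n m)}
    (hS : IsThickChain (resultWeight G w) (1 / 500) S) {t : ℕ}
    (ht : 0.9 * (m : ℝ) ≤ (S t).toRight.card) : 0.9 * (n : ℝ) ≤ (S (t + 1)).toLeft.card := by
  by_contra! hlt
  have hm' : (0 : ℝ) < m := by exact_mod_cast hm
  have hnm' : (n : ℝ) ≤ m := by exact_mod_cast hnm
  have hY : (0 : ℝ) < (S t).toRight.card := by linarith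
  have hge : (S t).toRight.card ≤ D * (S t).toRight.card / (40 * L) := by
    rw [le_div_iff₀ (by positivity)]; nlinarith
  have h1 := h.right (S (t + 1)).toLeft (S t).toRight
    (Finset.card_pos.1 (by exact_mod_cast hY)) hlt (by linarith)
  have h2 := cut_bounds hS t
  have h3 := h.vol_le (w := w) (S t)
  have h4 := h.edgeCount_ge (S t).toRight
  have h5 := edgeCount_nonneg G (S t).toLeft (S (t + 1)).toRightᶜ
  have h6 : D / 2 * (0.9 * m) ≤ D / 2 * (S t).toRight.card := by
    gcongr; linarith
  have h7 : (0 : ℝ) ≤ n * d := by positivity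
  nlinarith

/-- One side of `S t` carries at least half the volume. If the opposite side of `S (t + 1)` were
small, expansion would let more than `1/100` of that half escape, against the `2/500` that thickness
allows. The degree bounds turn the resulting cardinality back into volume. -/
lemma vol_growth (h : IsExpander G d D L) (hL : 0 < L) (hD0 : 0 < D) (hDd : D ≤ d)
    {S : ℕ → Finset (Subject n m)} (hS : IsThickChain (resultWeight G w) (1 / 500) S) {t : ℕ}
    (hvol : 0 < cutWeight (resultWeight G w) (S t) univ)
    (hl : ((S (t + 1)).toLeft.card : ℝ) < 0.9 * n) (hr : ((S (t + 1)).toRight.card : ℝ) < 0.9 * m) :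
    D / (240 * L) * cutWeight (resultWeight G w) (S t) univ ≤
      cutWeight (resultWeight G w) (S (t + 1)) univ := by
  have h2 := cut_bounds hS t
  have h5 := edgeCount_nonneg G (S t).toLeft (S (t + 1)).toRightᶜ
  have h6 := edgeCount_nonneg G (S (t + 1)).toLeftᶜ (S t).toRight
  have h7 := edgeCount_nonneg G univ (S (t + 1)).toRight
  have hd : (0 : ℝ) < d := hD0.trans_le hDd
  rw [h.vol_eq] at *
  rw [h.vol_eq]
  rcases le_total (edgeCount G univ (S t).toRight) (d * (S t).toLeft.card) with hc | hc
  · have hx : (0 : ℝ) < (S t).toLeft.card := by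
      by_contra! h0
      nlinarith
    have h1 : d * (S t).toLeft.card / (40 * L) ≤ ((S (t + 1)).toRight.card : ℝ) := by
      by_contra! hlt
      have := h.left (S t).toLeft (S (t + 1)).toRight (Finset.card_pos.1 (by exact_mod_cast hx))
        hr hlt
      nlinarith
    have h8 := h.edgeCount_ge (S (t + 1)).toRight
    calc D / (240 * L) * (d * (S t).toLeft.card + edgeCount G univ (S t).toRight)
        ≤ D / (240 * L) * (2 * (d * (S t).toLeft.card)) := by gcongr; linarith
      _ ≤ D / (160 * L) * (2 * (d * (S t).toLeft.card)) := by gcongr; norm_num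
      _ = D / 2 * (d * (S t).toLeft.card / (40 * L)) := by field_simp; norm_num
      _ ≤ D / 2 * (S (t + 1)).toRight.card := by gcongr
      _ ≤ _ := h8.trans (le_add_of_nonneg_left (by positivity))
  · have hy : (0 : ℝ) < (S t).toRight.card := by
      by_contra! h0
      have : (S t).toRight = ∅ := by
        rw [← Finset.card_eq_zero]; exact_mod_cast le_antisymm h0 (Nat.cast_nonneg _)
      have h9 := h.edgeCount_le (S t).toRight
      rw [this] at h9 hc hvol
      simp only [card_empty, Nat.cast_zero, mul_zero] at h9
      nlinarith
    have h1 : D * (S t).toRight.card / (40 * L) ≤ ((S (t + 1)).toLeft.card : ℝ) := by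
      by_contra! hlt
      have := h.right (S (t + 1)).toLeft (S t).toRight (Finset.card_pos.1 (by exact_mod_cast hy))
        hl hlt
      nlinarith
    have h8 := h.edgeCount_le (S t).toRight
    calc D / (240 * L) * (d * (S t).toLeft.card + edgeCount G univ (S t).toRight)
        ≤ d / (240 * L) * (2 * (3 * D * (S t).toRight.card)) := by
          refine mul_le_mul ?_ ?_ ?_ ?_
          · gcongr
          · linarith
          · linarith
          · positivity
      _ = d * (D * (S t).toRight.card / (40 * L)) := by field_simp; norm_num
      _ ≤ d * (S (t + 1)).toLeft.card := by gcongr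
      _ ≤ _ := le_add_of_nonneg_right h7

/-- A thick chain soon contains nine tenths of the students. -/
theorem card_toLeft_ge (h : IsExpander G d D L) (hm : 0 < m) (hnm : n ≤ m) (hL : 0 < L)
    (hDL : 40 * L ≤ D) (hD : D * m = n * d) (hDd : D ≤ d) {T : ℕ}
    (hT : 2 * (n : ℝ) < (D / (240 * L)) ^ T) {S : ℕ → Finset (Subject n m)}
    (hS : IsThickChain (resultWeight G w) (1 / 500) S) :
    0.9 * (n : ℝ) ≤ (S (T + 2)).toLeft.card := by
  by_contra! hlt
  have hD0 : 0 < D := by linarith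
  have hd : (0 : ℝ) < d := hD0.trans_le hDd
  have hmono : ∀ t ≤ T + 2, ((S t).toLeft.card : ℝ) < 0.9 * n := fun t ht => by
    refine lt_of_le_of_lt ?_ hlt
    exact_mod_cast Finset.card_le_card (Finset.toLeft_subset_toLeft (hS.mono ht))
  have hmono' : ∀ t ≤ T + 1, ((S t).toRight.card : ℝ) < 0.9 * m := fun t ht => by
    by_contra! hge
    exact absurd (h.right_saturated hm hnm hL hDL hD hS hge) (not_le.2 (hmono _ (by omega)))
  -- If `S 1` had no student, every edge at the questions of `S 0` would leave it. A student
  -- guarantees initial volume `d`; `T` growth steps and one saturation step then account for the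
  -- index `T + 2`.
  have h1 : (S 1).toLeft.Nonempty := by
    by_contra hne
    rw [Finset.not_nonempty_iff_eq_empty] at hne
    have h0 : (S 0).toLeft = ∅ := by
      have := Finset.toLeft_subset_toLeft (hS.mono (Nat.zero_le 1))
      rw [hne] at this
      exact Finset.subset_empty.1 this
    have hY : (S 0).toRight.Nonempty := by
      obtain ⟨a, ha⟩ := hS.nonempty
      rcases a with i | j
      · exact absurd (Finset.mem_toLeft.2 ha) (by simp [h0])
      · exact ⟨j, Finset.mem_toRight.2 ha⟩
    have h2 := cut_bounds hS 0
    have h5 := edgeCount_nonneg G (S 0).toLeft (S (0 + 1)).toRightᶜ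
    rw [h.vol_eq, zero_add, hne, h0] at h2
    rw [zero_add, h0] at h5
    have h3 := h.edgeCount_ge (S 0).toRight
    have h4 : (1 : ℝ) ≤ (S 0).toRight.card := by exact_mod_cast hY.card_pos
    simp only [compl_empty, card_empty, Nat.cast_zero, mul_zero, zero_add] at h2
    nlinarith
  have hg : 0 < D / (240 * L) := by positivity
  have hgrow : ∀ k ≤ T, (D / (240 * L)) ^ k * d ≤ cutWeight (resultWeight G w) (S (k + 1)) univ := by
    intro k
    induction k with
    | zero =>
      intro _
      rw [h.vol_eq]
      have h4 : (1 : ℝ) ≤ (S 1).toLeft.card := by exact_mod_cast h1.card_pos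
      have := edgeCount_nonneg G univ (S 1).toRight
      simp only [pow_zero, one_mul, zero_add]
      nlinarith
    | succ k ih =>
      intro hk
      have ih' := ih (by omega)
      have := h.vol_growth (w := w) hL hD0 hDd hS (t := k + 1)
        (lt_of_lt_of_le (by positivity) ih') (hmono _ (by omega)) (hmono' _ (by omega))
      refine le_trans ?_ this
      rw [pow_succ', mul_assoc]
      exact mul_le_mul_of_nonneg_left ih' hg.le
  have h2 := (hgrow T le_rfl).trans (h.vol_le _)
  nlinarith

theorem thickChains_meet (h : IsExpander G d D L) (hn : 0 < n) (hnm : n ≤ m) (hL : 0 < L)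
    (hDL : 40 * L ≤ D) (hD : D * m = n * d) (hDd : D ≤ d) {T : ℕ}
    (hT : 2 * (n : ℝ) < (D / (240 * L)) ^ T) {S S' : ℕ → Finset (Subject n m)}
    (hS : IsThickChain (resultWeight G w) (1 / 500) S)
    (hS' : IsThickChain (resultWeight G w) (1 / 500) S') :
    ∃ a, a ∈ S (T + 2) ∧ a ∈ S' (T + 2) := by
  have h1 := h.card_toLeft_ge (hn.trans_le hnm) hnm hL hDL hD hDd hT hS
  have h2 := h.card_toLeft_ge (hn.trans_le hnm) hnm hL hDL hD hDd hT hS'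
  have h3 : (((S (T + 2)).toLeft ∩ (S' (T + 2)).toLeft).card : ℝ) +
      ((S (T + 2)).toLeft ∪ (S' (T + 2)).toLeft).card =
      (S (T + 2)).toLeft.card + (S' (T + 2)).toLeft.card := by
    exact_mod_cast Finset.card_inter_add_card_union _ _
  have h4 : (((S (T + 2)).toLeft ∪ (S' (T + 2)).toLeft).card : ℝ) ≤ n := by
    exact_mod_cast card_finset_fin_le _
  have hn' : (0 : ℝ) < n := by exact_mod_cast hn
  have h5 : (0 : ℝ) < ((S (T + 2)).toLeft ∩ (S' (T + 2)).toLeft).card := by linarith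
  obtain ⟨i, hi⟩ := Finset.card_pos.1 (by exact_mod_cast h5)
  rw [Finset.mem_inter, Finset.mem_toLeft, Finset.mem_toLeft] at hi
  exact ⟨_, hi⟩

end IsExpander

end Expander

/-! ### Exponential moments for sampling without replacement. -/

section AssignmentLaw

lemma pow_mul_choose_le {w m : ℕ} (hwm : w ≤ m) (k : ℕ) :
    m ^ k * w.choose k ≤ w ^ k * m.choose k := by
  have key : m ^ k * w.descFactorial k ≤ w ^ k * m.descFactorial k := by
    induction k with
    | zero => simp
    | succ k ih =>
      have h : m * (w - k) ≤ w * (m - k) := by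
        rw [Nat.mul_sub, Nat.mul_sub, mul_comm w m]
        exact Nat.sub_le_sub_left (Nat.mul_le_mul_right k hwm) _
      calc m ^ (k + 1) * w.descFactorial (k + 1)
          = (m * (w - k)) * (m ^ k * w.descFactorial k) := by
            rw [Nat.descFactorial_succ]; ring
        _ ≤ (w * (m - k)) * (w ^ k * m.descFactorial k) := Nat.mul_le_mul h ih
        _ = _ := by rw [Nat.descFactorial_succ]; ring
  rw [Nat.descFactorial_eq_factorial_mul_choose, Nat.descFactorial_eq_factorial_mul_choose] at key
  refine le_of_mul_le_mul_left ?_ k.factorial_pos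
  calc _ = m ^ k * (k.factorial * w.choose k) := by ring
    _ ≤ _ := key
    _ = _ := by ring

/-- Sampling without replacement: the generating function of the hypergeometric distribution is
dominated by that of the binomial distribution. -/
lemma sum_powersetCard_pow_card_inter_le {m d : ℕ} (hm : 0 < m) (W : Finset (Fin m)) {θ : ℝ}
    (hθ : 0 ≤ θ) :
    ∑ J ∈ powersetCard d (univ : Finset (Fin m)), (1 + θ) ^ (J ∩ W).card ≤
      m.choose d * (1 + W.card / m * θ) ^ d := by
  -- Binomial expansion over subsets `T` of `J ∩ W`; exchanging sums reduces the claim to counting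
  -- the `J` that contain a given `T`.
  have hexp : ∀ J : Finset (Fin m), (1 + θ) ^ (J ∩ W).card =
      ∑ T ∈ W.powerset, if T ⊆ J then θ ^ T.card else 0 := by
    intro J
    rw [add_comm, ← Finset.sum_pow_mul_eq_add_pow, ← Finset.sum_filter]
    simp only [one_pow, mul_one]
    refine Finset.sum_congr ?_ fun _ _ => rfl
    ext T
    simp only [mem_powerset, mem_filter, Finset.subset_inter_iff]
    exact and_comm
  have hcount : ∀ T ∈ W.powerset, (∑ J ∈ powersetCard d (univ : Finset (Fin m)),
      if T ⊆ J then θ ^ T.card else 0) ≤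
      θ ^ T.card * if T.card ≤ d then ((m - T.card).choose (d - T.card) : ℝ) else 0 := by
    intro T _
    rw [← Finset.sum_filter, Finset.sum_const, nsmul_eq_mul, mul_comm]
    split_ifs with h
    · rw [card_filter_powersetCard_subset _ _ _ (Finset.subset_univ T) h]
      simp
    · rw [Finset.filter_false_of_mem, Finset.card_empty]
      · simp
      · intro J hJ hTJ
        exact h ((Finset.card_le_card hTJ).trans (Finset.mem_powersetCard.1 hJ).2.le)
  simp only [hexp]
  rw [Finset.sum_comm]
  refine (Finset.sum_le_sum hcount).trans ?_
  rw [Finset.sum_powerset_apply_card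
    (fun k => θ ^ k * if k ≤ d then ((m - k).choose (d - k) : ℝ) else 0)]
  have hm' : (0 : ℝ) < m := by exact_mod_cast hm
  have hterm : ∀ k, W.card.choose k • (θ ^ k * if k ≤ d then ((m - k).choose (d - k) : ℝ) else 0) ≤
      m.choose d * ((W.card / m * θ) ^ k * d.choose k) := by
    intro k
    rw [nsmul_eq_mul]
    split_ifs with h
    · have h1 : (W.card.choose k : ℝ) ≤ (W.card / m) ^ k * m.choose k := by
        rw [div_pow, div_mul_eq_mul_div, le_div_iff₀ (by positivity), mul_comm]
        exact_mod_cast pow_mul_choose_le (card_finset_fin_le W) k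
      have h2 : (m.choose d : ℝ) * d.choose k = m.choose k * (m - k).choose (d - k) := by
        exact_mod_cast Nat.choose_mul h
      calc (W.card.choose k : ℝ) * (θ ^ k * (m - k).choose (d - k))
          ≤ (W.card / m) ^ k * m.choose k * (θ ^ k * (m - k).choose (d - k)) := by gcongr
        _ = (W.card / m) ^ k * θ ^ k * (m.choose k * (m - k).choose (d - k)) := by ring
        _ = _ := by rw [← h2, mul_pow]; ring
    · simp only [mul_zero]
      positivity
  refine (Finset.sum_le_sum fun k _ => hterm k).trans ?_
  rw [← Finset.mul_sum]
  refine mul_le_mul_of_nonneg_left ?_ (Nat.cast_nonneg _)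
  rw [add_comm 1, add_pow]
  simp only [one_pow, mul_one]
  rcases le_total W.card d with h | h
  · exact Finset.sum_le_sum_of_subset_of_nonneg (Finset.range_mono (by omega))
      fun k _ _ => by positivity
  · refine (Finset.sum_subset (Finset.range_mono (by omega)) fun k _ hk => ?_).ge
    rw [Nat.choose_eq_zero_of_lt (by simpa using hk)]
    simp

instance instMeasurableSingletonClassFinset {m : ℕ} : MeasurableSingletonClass (Finset (Fin m)) where
  measurableSet_singleton J := by
    have : ({J} : Set (Finset (Fin m))) = ⋂ a, {s | a ∈ s ↔ a ∈ J} := by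
      ext s; simp [Finset.ext_iff]
    rw [this]
    refine MeasurableSet.iInter fun a => ?_
    by_cases h : a ∈ J
    · simpa [h] using measurable_finset_mem a
    · simpa [h] using measurable_finset_notMem a

variable {n m d : ℕ}

lemma isProbabilityMeasure_uniformOn_card (hd : d ≤ m) :
    IsProbabilityMeasure (uniformOn {J : Finset (Fin m) | J.card = d}) := by
  refine isProbabilityMeasure_uniformOn (Set.toFinite _) ?_
  obtain ⟨J, -, hJ⟩ := Finset.exists_subset_card_eq (s := (univ : Finset (Fin m))) (by simpa using hd)
  exact ⟨J, hJ⟩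

lemma integral_uniformOn_card (f : Finset (Fin m) → ℝ) :
    ∫ J, f J ∂uniformOn {J : Finset (Fin m) | J.card = d} =
      (∑ J ∈ powersetCard d univ, f J) / m.choose d := by
  have hset : {J : Finset (Fin m) | J.card = d} =
      ((powersetCard d univ : Finset (Finset (Fin m))) : Set (Finset (Fin m))) := by
    ext J; simp
  have hfin : IsFiniteMeasure (uniformOn {J : Finset (Fin m) | J.card = d}) := by
    unfold uniformOn; infer_instance
  rw [integral_fintype (Integrable.of_finite), Finset.sum_div,
    ← Finset.sum_subset (Finset.subset_univ (powersetCard d univ))]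
  · refine Finset.sum_congr rfl fun J hJ => ?_
    rw [measureReal_def, hset, ← Finset.coe_singleton, uniformOn_apply_finset]
    simp [Finset.inter_singleton_of_mem hJ, div_eq_inv_mul]
  · intro J _ hJ
    rw [measureReal_def, hset, ← Finset.coe_singleton, uniformOn_apply_finset]
    simp [Finset.inter_singleton_of_notMem hJ]

lemma integral_exp_card_inter_le (hm : 0 < m) (hd : d ≤ m) (W : Finset (Fin m)) (l : ℝ) :
    ∫ J, Real.exp (l * (J ∩ W).card) ∂uniformOn {J : Finset (Fin m) | J.card = d} ≤
      Real.exp (d * (W.card / m) * (Real.exp l - 1)) := by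
  have hm' : (0 : ℝ) < m := by exact_mod_cast hm
  have hC : (0 : ℝ) < m.choose d := by exact_mod_cast Nat.choose_pos hd
  have hW : (W.card : ℝ) / m ≤ 1 := by
    rw [div_le_one hm']; exact_mod_cast card_finset_fin_le W
  have hnn : 0 ≤ 1 + W.card / m * (Real.exp l - 1) := by
    have : 0 ≤ (W.card : ℝ) / m := by positivity
    nlinarith [Real.exp_pos l]
  have hpow : (1 + W.card / m * (Real.exp l - 1)) ^ d ≤
      Real.exp (d * (W.card / m) * (Real.exp l - 1)) := by
    rw [mul_assoc, Real.exp_nat_mul]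
    refine pow_le_pow_left₀ hnn ?_ d
    linarith [Real.add_one_le_exp (W.card / m * (Real.exp l - 1))]
  refine le_trans ?_ hpow
  rw [integral_uniformOn_card, div_le_iff₀ hC, mul_comm]
  rcases le_total 0 l with hl | hl
  · have h := sum_powersetCard_pow_card_inter_le (d := d) hm W (θ := Real.exp l - 1)
      (by linarith [Real.add_one_le_exp l])
    refine le_trans (le_of_eq (Finset.sum_congr rfl fun J _ => ?_)) h
    rw [mul_comm, Real.exp_nat_mul]
    congr 1
    ring
  -- For negative `l` the generating function bound does not apply to `W`, but `|J ∩ W| = d - |J ∩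
  -- Wᶜ|` reverses the sign.
  · have h := sum_powersetCard_pow_card_inter_le (d := d) hm Wᶜ (θ := Real.exp (-l) - 1)
      (by linarith [Real.add_one_le_exp (-l)])
    have hterm : ∀ J ∈ powersetCard d (univ : Finset (Fin m)), Real.exp (l * (J ∩ W).card) =
        Real.exp l ^ d * (1 + (Real.exp (-l) - 1)) ^ (J ∩ Wᶜ).card := by
      intro J hJ
      have hc : (J ∩ W).card + (J ∩ Wᶜ).card = d := by
        rw [← (Finset.mem_powersetCard.1 hJ).2, ← Finset.sdiff_eq_inter_compl]
        exact Finset.card_inter_add_card_sdiff J W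
      rw [add_sub_cancel, ← Real.exp_nat_mul, ← Real.exp_nat_mul, ← Real.exp_add, ← hc]
      congr 1
      push_cast
      ring
    rw [Finset.sum_congr rfl hterm, ← Finset.mul_sum]
    refine (mul_le_mul_of_nonneg_left h (by positivity)).trans (le_of_eq ?_)
    have hcompl : ((Wᶜ).card : ℝ) = m - W.card := by
      rw [Finset.card_compl, Fintype.card_fin, Nat.cast_sub (card_finset_fin_le W)]
    rw [mul_left_comm, ← mul_pow, hcompl]
    congr 2
    have h1 : Real.exp l * Real.exp (-l) = 1 := by rw [← Real.exp_add]; simp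
    field_simp
    linear_combination (m - W.card : ℝ) * h1

lemma isProbabilityMeasure_assignmentLaw (hd : d ≤ m) :
    IsProbabilityMeasure (assignmentLaw n m d) := by
  have := isProbabilityMeasure_uniformOn_card hd
  unfold assignmentLaw
  infer_instance

/-- Chernoff bound for the numbers of edges between the students and a set of questions. -/
lemma assignmentLaw_tail_le (hm : 0 < m) (hd : d ≤ m) (W : Finset (Fin m)) (l : Fin n → ℝ) (ε : ℝ) :
    (assignmentLaw n m d).real {G | ε ≤ ∑ i, l i * ((G i ∩ W).card : ℝ)} ≤
      Real.exp (-ε + d * (W.card / m) * ∑ i, (Real.exp (l i) - 1)) := by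
  have := isProbabilityMeasure_uniformOn_card hd
  have := isProbabilityMeasure_assignmentLaw (n := n) hd
  -- The Chernoff parameter is `1` because the weights `l` already carry the scale.
  have h := measure_ge_le_exp_mul_mgf (μ := assignmentLaw n m d)
    (X := fun G => ∑ i, l i * ((G i ∩ W).card : ℝ)) ε zero_le_one Integrable.of_finite
  refine h.trans ?_
  rw [Real.exp_add, neg_one_mul]
  refine mul_le_mul_of_nonneg_left ?_ (Real.exp_nonneg _)
  rw [mgf, Finset.mul_sum, Real.exp_sum]
  simp only [one_mul, Real.exp_sum]
  unfold assignmentLaw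
  rw [integral_fintype_prod_eq_prod (μ := fun _ : Fin n => uniformOn {J : Finset (Fin m) | J.card = d})
    (fun i (J : Finset (Fin m)) => Real.exp (l i * ((J ∩ W).card : ℝ)))]
  exact Finset.prod_le_prod (fun i _ => integral_nonneg fun _ => Real.exp_nonneg _)
    fun i _ => integral_exp_card_inter_le hm hd W (l i)

lemma ae_card_eq (hd : d ≤ m) : ∀ᵐ G ∂assignmentLaw n m d, ∀ i, (G i).card = d := by
  have := isProbabilityMeasure_uniformOn_card hd
  rw [ae_all_iff]
  intro i
  have h : ∀ᵐ J ∂uniformOn {J : Finset (Fin m) | J.card = d}, J.card = d := by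
    unfold uniformOn
    exact ae_cond_mem (Set.toFinite _).measurableSet
  exact (Measure.quasiMeasurePreserving_eval
    (fun _ : Fin n => uniformOn {J : Finset (Fin m) | J.card = d}) i).ae h

end AssignmentLaw

/-! ### Expansion of the random assignment graph. -/

section AssignmentLawExpander

variable {n m d : ℕ}

/-- The union bound over all vertex sets converges: with weight `e^{-L} = 1 / (n + m)` per vertex
the sum is `(1 + 1 / (n + m)) ^ (n + m) ≤ e`. -/
lemma sum_sum_exp_card_le {L : ℝ} (hL : Real.exp L = n + m) :
    ∑ X : Finset (Fin n), ∑ Y : Finset (Fin m), Real.exp (-((X.card + Y.card + 4) * L)) ≤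
      3 * Real.exp (-(4 * L)) := by
  have hterm : ∀ (X : Finset (Fin n)) (Y : Finset (Fin m)),
      Real.exp (-((X.card + Y.card + 4) * L)) =
        Real.exp (-(4 * L)) * (Real.exp (-L) ^ X.card * Real.exp (-L) ^ Y.card) := by
    intro X Y
    rw [← Real.exp_nat_mul, ← Real.exp_nat_mul, ← Real.exp_add, ← Real.exp_add]
    congr 1
    ring
  have hbin : ∀ k : ℕ, ∑ X : Finset (Fin k), Real.exp (-L) ^ X.card = (Real.exp (-L) + 1) ^ k := by
    intro k
    rw [← Fin.sum_pow_mul_eq_add_pow]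
    simp
  simp only [hterm, ← Finset.mul_sum]
  rw [← Finset.sum_mul, hbin, hbin, ← pow_add, mul_comm]
  refine mul_le_mul_of_nonneg_right ?_ (Real.exp_nonneg _)
  calc (Real.exp (-L) + 1) ^ (n + m) ≤ Real.exp (Real.exp (-L)) ^ (n + m) :=
        pow_le_pow_left₀ (by positivity) (Real.add_one_le_exp _) _
    _ = Real.exp 1 := by
        rw [← Real.exp_nat_mul]
        push_cast
        rw [← hL, ← Real.exp_add, add_neg_cancel, Real.exp_zero]
    _ ≤ 3 := by linarith [Real.exp_one_lt_d9]

lemma measureReal_iUnion_iUnion_le {Ω : Type*} [MeasurableSpace Ω] (μ : Measure Ω)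
    [IsFiniteMeasure μ] {L : ℝ} (hL : Real.exp L = n + m)
    (A : Finset (Fin n) → Finset (Fin m) → Set Ω)
    (hA : ∀ X Y, μ.real (A X Y) ≤ Real.exp (-((X.card + Y.card + 4) * L))) :
    μ.real (⋃ X, ⋃ Y, A X Y) ≤ 3 * Real.exp (-(4 * L)) :=
  calc μ.real (⋃ X, ⋃ Y, A X Y) ≤ ∑ X, μ.real (⋃ Y, A X Y) := measureReal_iUnion_fintype_le _
    _ ≤ ∑ X, ∑ Y, μ.real (A X Y) :=
        Finset.sum_le_sum fun _ _ => measureReal_iUnion_fintype_le _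
    _ ≤ _ := Finset.sum_le_sum fun _ _ => Finset.sum_le_sum fun _ _ => hA _ _
    _ ≤ _ := sum_sum_exp_card_le hL

lemma edgeCount_eq_sum_ite (G : Assignment n m) (X : Finset (Fin n)) (Y : Finset (Fin m)) :
    edgeCount G X Y = ∑ i, (if i ∈ X then 1 else 0) * ((G i ∩ Y).card : ℝ) := by
  simp [edgeCount]

lemma sum_ite_sub_one (X : Finset (Fin n)) (a b : ℝ) :
    ∑ i, (Real.exp (if i ∈ X then a else b) - 1) =
      X.card * (Real.exp a - 1) + (n - X.card) * (Real.exp b - 1) := by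
  have h : ∀ i, Real.exp (if i ∈ X then a else b) - 1 =
      (if i ∈ X then (Real.exp a - Real.exp b) else 0) + (Real.exp b - 1) := by
    intro i; split_ifs <;> ring
  simp only [h, Finset.sum_add_distrib, Finset.sum_ite_mem, Finset.univ_inter, Finset.sum_const,
    Finset.card_univ, Fintype.card_fin, nsmul_eq_mul]
  ring

variable {D L : ℝ}

lemma prob_deg_lt_le (hm : 0 < m) (hd : d ≤ m) (hD : D * m = n * d) (hDL : 400 * L ≤ D)
    (hL : 0 ≤ L) (j : Fin m) :
    (assignmentLaw n m d).real {G | edgeCount G univ {j} < D / 2} ≤ Real.exp (-(5 * L)) := by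
  have := isProbabilityMeasure_assignmentLaw (n := n) hd
  have hm' : (0 : ℝ) < m := by exact_mod_cast hm
  refine (measureReal_mono ?_).trans
    ((assignmentLaw_tail_le hm hd {j} (fun _ => -1) (-(D / 2))).trans (Real.exp_le_exp.2 ?_))
  · intro G hG
    simp only [Set.mem_ofPred_eq, edgeCount] at hG ⊢
    rw [← Finset.mul_sum]
    linarith
  · have hn : (d : ℝ) * (1 / m) * n = D := by field_simp; linarith
    have he : Real.exp (-1) ≤ 0.37 := by linarith [Real.exp_neg_one_lt_d9]
    simp only [card_singleton, Nat.cast_one, Finset.sum_const, Finset.card_univ, Fintype.card_fin,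
      nsmul_eq_mul]
    rw [← mul_assoc, hn]
    nlinarith

lemma prob_deg_gt_le (hm : 0 < m) (hd : d ≤ m) (hD : D * m = n * d) (hDL : 400 * L ≤ D)
    (hL : 0 ≤ L) (j : Fin m) :
    (assignmentLaw n m d).real {G | 3 * D < edgeCount G univ {j}} ≤ Real.exp (-(5 * L)) := by
  have := isProbabilityMeasure_assignmentLaw (n := n) hd
  have hm' : (0 : ℝ) < m := by exact_mod_cast hm
  refine (measureReal_mono ?_).trans
    ((assignmentLaw_tail_le hm hd {j} (fun _ => 1) (3 * D)).trans (Real.exp_le_exp.2 ?_))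
  · intro G hG
    simp only [Set.mem_ofPred_eq, edgeCount] at hG ⊢
    rw [← Finset.mul_sum]
    linarith
  · have hn : (d : ℝ) * (1 / m) * n = D := by field_simp; linarith
    have he : Real.exp 1 ≤ 2.72 := by linarith [Real.exp_one_lt_d9]
    simp only [card_singleton, Nat.cast_one, Finset.sum_const, Finset.card_univ, Fintype.card_fin,
      nsmul_eq_mul]
    rw [← mul_assoc, hn]
    nlinarith

/-- At least a tenth of the questions lie in `Yᶜ`, so Chernoff gives exponent at most `-0.053 d
|X|`. The terms `|X| L`, `|Y| L` and `4 L` cost at most `0.0025`, `0.025` and `0.01` times `d |X|`.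
-/
lemma prob_left_le (hm : 0 < m) (hd : d ≤ m) (hdL : 400 * L ≤ d) (hL : 0 < L)
    {X : Finset (Fin n)} {Y : Finset (Fin m)} (hX : X.Nonempty) (hY : (Y.card : ℝ) < 0.9 * m)
    (hXY : (Y.card : ℝ) < d * X.card / (40 * L)) :
    (assignmentLaw n m d).real {G | edgeCount G X Yᶜ ≤ 0.01 * (d * X.card)} ≤
      Real.exp (-((X.card + Y.card + 4) * L)) := by
  have := isProbabilityMeasure_assignmentLaw (n := n) hd
  have hm' : (0 : ℝ) < m := by exact_mod_cast hm
  refine (measureReal_mono ?_).trans ((assignmentLaw_tail_le hm hd Yᶜ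
    (fun i => if i ∈ X then -1 else 0) (-(0.01 * (d * X.card)))).trans (Real.exp_le_exp.2 ?_))
  · intro G hG
    simp only [Set.mem_ofPred_eq, edgeCount_eq_sum_ite] at hG ⊢
    rw [neg_le, ← Finset.sum_neg_distrib]
    refine le_trans (le_of_eq (Finset.sum_congr rfl fun i _ => ?_)) hG
    split_ifs <;> simp
  · rw [sum_ite_sub_one]
    have he : Real.exp (-1) ≤ 0.37 := by linarith [Real.exp_neg_one_lt_d9]
    have hc : ((Yᶜ).card : ℝ) = m - Y.card := by
      rw [Finset.card_compl, Fintype.card_fin, Nat.cast_sub (card_finset_fin_le Y)]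
    have hq : 0.1 ≤ ((Yᶜ).card : ℝ) / m := by
      rw [le_div_iff₀ hm', hc]; linarith
    have hx : (1 : ℝ) ≤ X.card := by exact_mod_cast hX.card_pos
    rw [lt_div_iff₀ (by positivity)] at hXY
    simp only [Real.exp_zero, sub_self, mul_zero, add_zero]
    have h1 : (d : ℝ) * X.card * 0.1 * 0.63 ≤
        d * X.card * ((Yᶜ).card / m) * (1 - Real.exp (-1)) := by
      gcongr
      linarith
    have h2 : 400 * L * X.card ≤ d * X.card := by gcongr
    nlinarith

/-- Both sides of the event are random, so they are combined: it says that `0.01 e(X, Y) - 0.99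
e(Xᶜ, Y) ≥ 0`, a single tail event with weights `0.01` on `X` and `-0.99` off it. Its exponent
`-0.04 D |Y|` beats the required `0.0375 D |Y|`. -/
lemma prob_right_le (hm : 0 < m) (hd : d ≤ m) (hD : D * m = n * d) (hDL : 400 * L ≤ D) (hL : 0 < L)
    {X : Finset (Fin n)} {Y : Finset (Fin m)} (hY : Y.Nonempty) (hX : (X.card : ℝ) < 0.9 * n)
    (hXY : (X.card : ℝ) < D * Y.card / (40 * L)) :
    (assignmentLaw n m d).real {G | edgeCount G Xᶜ Y ≤ 0.01 * edgeCount G univ Y} ≤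
      Real.exp (-((X.card + Y.card + 4) * L)) := by
  have := isProbabilityMeasure_assignmentLaw (n := n) hd
  have hm' : (0 : ℝ) < m := by exact_mod_cast hm
  refine (measureReal_mono ?_).trans ((assignmentLaw_tail_le hm hd Y
    (fun i => if i ∈ X then 0.01 else -0.99) 0).trans (Real.exp_le_exp.2 ?_))
  · intro G hG
    simp only [Set.mem_ofPred_eq, edgeCount_eq_sum_ite] at hG ⊢
    rw [Finset.mul_sum, ← sub_nonneg, ← Finset.sum_sub_distrib] at hG
    refine hG.trans (le_of_eq (Finset.sum_congr rfl fun i _ => ?_))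
    by_cases h : i ∈ X
    · simp [h]
    · simp [h]
      ring
  · rw [sum_ite_sub_one]
    have he : Real.exp 0.01 ≤ 1.0102 := by
      have h1 := Real.add_one_le_exp (-0.01)
      have h2 : Real.exp 0.01 * Real.exp (-0.01) = 1 := by rw [← Real.exp_add]; simp
      nlinarith [Real.exp_pos 0.01]
    have he' : Real.exp (-0.99) ≤ 0.503 := by
      have h1 := Real.add_one_le_exp 0.99
      have h2 : Real.exp 0.99 * Real.exp (-0.99) = 1 := by rw [← Real.exp_add]; simp
      nlinarith [Real.exp_pos (-0.99)]
    have hy : (1 : ℝ) ≤ Y.card := by exact_mod_cast hY.card_pos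
    rw [lt_div_iff₀ (by positivity)] at hXY
    have hin : (X.card : ℝ) * (Real.exp 0.01 - 1) + (n - X.card) * (Real.exp (-0.99) - 1) ≤
        -(0.04 * n) := by
      nlinarith [Nat.cast_nonneg (α := ℝ) X.card]
    have h1 : d * (Y.card / m) * (X.card * (Real.exp 0.01 - 1) +
        (n - X.card) * (Real.exp (-0.99) - 1)) ≤ d * (Y.card / m) * -(0.04 * n) :=
      mul_le_mul_of_nonneg_left hin (by positivity)
    have h2 : d * (Y.card / m) * -(0.04 * n) = -(0.04 * (D * Y.card)) := by
      field_simp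
      linear_combination hD
    have h3 : 400 * L * Y.card ≤ D * Y.card := by gcongr
    rw [h2] at h1
    refine (add_le_add_right h1 _).trans ?_
    nlinarith

/-- The task assignment graph is an expander with high probability. -/
theorem prob_not_isExpander_le (hm : 0 < m) (hd : d ≤ m) (hD : D * m = n * d) (hDL : 400 * L ≤ D)
    (hDd : D ≤ d) (hL : 0 < L) (hLe : Real.exp L = n + m) :
    (assignmentLaw n m d).real {G | ¬IsExpander G d D L} ≤ 8 * Real.exp (-(4 * L)) := by
  have := isProbabilityMeasure_assignmentLaw (n := n) hd
  set μ := assignmentLaw n m d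
  let A1 : Set (Assignment n m) := ⋃ j, {G | edgeCount G univ {j} < D / 2}
  let A2 : Set (Assignment n m) := ⋃ j, {G | 3 * D < edgeCount G univ {j}}
  let A3 : Set (Assignment n m) := ⋃ X : Finset (Fin n), ⋃ Y : Finset (Fin m),
    {G | (X.Nonempty ∧ (Y.card : ℝ) < 0.9 * m ∧ (Y.card : ℝ) < d * X.card / (40 * L)) ∧
      edgeCount G X Yᶜ ≤ 0.01 * (d * X.card)}
  let A4 : Set (Assignment n m) := ⋃ X : Finset (Fin n), ⋃ Y : Finset (Fin m),
    {G | (Y.Nonempty ∧ (X.card : ℝ) < 0.9 * n ∧ (X.card : ℝ) < D * Y.card / (40 * L)) ∧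
      edgeCount G Xᶜ Y ≤ 0.01 * edgeCount G univ Y}
  -- The inclusion is only almost sure, since the exact degree `d` of every student holds almost
  -- surely.
  have hsub : {G | ¬IsExpander G d D L} ≤ᵐ[μ] ((A1 ∪ A2 ∪ (A3 ∪ A4) : Set (Assignment n m))) := by
    filter_upwards [ae_card_eq (n := n) hd] with G hG hnot
    by_contra hcon
    change ¬ G ∈ A1 ∪ A2 ∪ (A3 ∪ A4) at hcon
    simp only [A1, A2, A3, A4, Set.mem_union, Set.mem_iUnion, Set.mem_ofPred_eq, not_or, not_exists,
      not_and, not_lt, not_le] at hcon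
    obtain ⟨⟨h1, h2⟩, h3, h4⟩ := hcon
    exact hnot ⟨hG, h1, h2, fun X Y a b c => h3 X Y ⟨a, b, c⟩, fun X Y a b c => h4 X Y ⟨a, b, c⟩⟩
  have h5 : (m : ℝ) * Real.exp (-(5 * L)) ≤ Real.exp (-(4 * L)) := by
    rw [show -(4 * L) = L + -(5 * L) by ring, Real.exp_add, hLe]
    gcongr
    linarith [Nat.cast_nonneg (α := ℝ) n]
  have hA1 : μ.real A1 ≤ Real.exp (-(4 * L)) := by
    refine (measureReal_iUnion_fintype_le _).trans ?_
    refine (Finset.sum_le_sum fun j _ => prob_deg_lt_le hm hd hD hDL hL.le j).trans ?_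
    simpa using h5
  have hA2 : μ.real A2 ≤ Real.exp (-(4 * L)) := by
    refine (measureReal_iUnion_fintype_le _).trans ?_
    refine (Finset.sum_le_sum fun j _ => prob_deg_gt_le hm hd hD hDL hL.le j).trans ?_
    simpa using h5
  have hA3 : μ.real A3 ≤ 3 * Real.exp (-(4 * L)) := by
    refine measureReal_iUnion_iUnion_le μ hLe _ fun X Y => ?_
    by_cases h : X.Nonempty ∧ (Y.card : ℝ) < 0.9 * m ∧ (Y.card : ℝ) < d * X.card / (40 * L)
    · simpa [h] using prob_left_le hm hd (hDL.trans hDd) hL h.1 h.2.1 h.2.2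
    · simp only [h, false_and, Set.ofPred_false, measureReal_empty]
      positivity
  have hA4 : μ.real A4 ≤ 3 * Real.exp (-(4 * L)) := by
    refine measureReal_iUnion_iUnion_le μ hLe _ fun X Y => ?_
    by_cases h : Y.Nonempty ∧ (X.card : ℝ) < 0.9 * n ∧ (X.card : ℝ) < D * Y.card / (40 * L)
    · simpa [h] using prob_right_le hm hd hD hDL hL h.1 h.2.1 h.2.2
    · simp only [h, false_and, Set.ofPred_false, measureReal_empty]
      positivity
  have hle : μ.real {G | ¬IsExpander G d D L} ≤ μ.real (A1 ∪ A2 ∪ (A3 ∪ A4)) :=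
    ENNReal.toReal_mono (measure_ne_top _ _) (measure_mono_ae hsub)
  have u1 := measureReal_union_le (μ := μ) (A1 ∪ A2) (A3 ∪ A4)
  have u2 := measureReal_union_le (μ := μ) A1 A2
  have u3 := measureReal_union_le (μ := μ) A3 A4
  linarith

end AssignmentLawExpander

/-! ### Hoeffding bounds for the answers. -/

section AnswersLaw

variable {n m : ℕ}

instance isProbabilityMeasure_answersLaw (u : Subject n m → ℝ) :
    IsProbabilityMeasure (answersLaw n m u) := by
  unfold answersLaw
  infer_instance

/-- The centred answer of a student to a question. -/
def answerNoise (u : Subject n m → ℝ) (w : Answers n m) (p : Fin n × Fin m) : ℝ :=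
  (if w p = true then 1 else 0) - Real.sigmoid (u (Sum.inl p.1) - u (Sum.inr p.2))

lemma hasSubgaussianMGF_answerNoise (u : Subject n m → ℝ) (p : Fin n × Fin m) :
    HasSubgaussianMGF (fun w => answerNoise u w p) (1 / 4) (answersLaw n m u) := by
  have hint : ∫ w, (if w p = true then (1 : ℝ) else 0) ∂answersLaw n m u =
      Real.sigmoid (u (Sum.inl p.1) - u (Sum.inr p.2)) := by
    unfold answersLaw
    rw [integral_comp_eval (μ := fun p : Fin n × Fin m => bernoulliMeasure true false
      (unitInterval.sigmoid (u (Sum.inl p.1) - u (Sum.inr p.2)))) (i := p)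
      (f := fun b : Bool => if b = true then (1 : ℝ) else 0)
      (Measurable.of_discrete.aestronglyMeasurable)]
    rw [integral_bernoulliMeasure]
    simp
    rfl
  have h := hasSubgaussianMGF_of_mem_Icc (μ := answersLaw n m u)
    (X := fun w => if w p = true then (1 : ℝ) else 0) (a := 0) (b := 1)
    (Measurable.of_discrete.aemeasurable)
    (Filter.Eventually.of_forall fun w => by split_ifs <;> simp)
  rw [hint] at h
  have hc : (‖(1 : ℝ) - 0‖₊ / 2) ^ 2 = 1 / 4 := by
    rw [sub_zero, nnnorm_one]
    norm_num
  rw [hc] at h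
  exact h

lemma prob_sum_answerNoise_gt_le (u : Subject n m → ℝ) (P : Finset (Fin n × Fin m)) {η : ℝ}
    (hη : 0 ≤ η) :
    (answersLaw n m u).real {w | η * P.card < |∑ p ∈ P, answerNoise u w p|} ≤
      2 * Real.exp (-(2 * η ^ 2 * P.card)) := by
  have hind : iIndepFun (fun p w => answerNoise u w p) (answersLaw n m u) :=
    iIndepFun_pi (X := fun (p : Fin n × Fin m) (b : Bool) =>
      (if b = true then (1 : ℝ) else 0) - Real.sigmoid (u (Sum.inl p.1) - u (Sum.inr p.2)))
      fun p => Measurable.of_discrete.aemeasurable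
  have hind' : iIndepFun (fun p w => -answerNoise u w p) (answersLaw n m u) :=
    hind.comp (fun _ x => -x) fun _ => measurable_neg
  have h1 := HasSubgaussianMGF.measure_sum_ge_le_of_iIndepFun hind (s := P)
    (fun p _ => hasSubgaussianMGF_answerNoise u p) (ε := η * P.card) (by positivity)
  have h2 := HasSubgaussianMGF.measure_sum_ge_le_of_iIndepFun hind' (s := P)
    (fun p _ => (hasSubgaussianMGF_answerNoise u p).neg) (ε := η * P.card) (by positivity)
  have hexp : -(η * P.card) ^ 2 / (2 * ((∑ _p ∈ P, (1 / 4 : NNReal) : NNReal) : ℝ)) =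
      -(2 * η ^ 2 * P.card) := by
    rcases P.eq_empty_or_nonempty with rfl | hP
    · simp
    · have : (0 : ℝ) < P.card := by exact_mod_cast hP.card_pos
      push_cast
      rw [Finset.sum_const, nsmul_eq_mul]
      field_simp
      norm_num
  rw [hexp] at h1 h2
  have hsub : {w | η * P.card < |∑ p ∈ P, answerNoise u w p|} ⊆
      {w | η * P.card ≤ ∑ p ∈ P, answerNoise u w p} ∪
        {w | η * P.card ≤ ∑ p ∈ P, -answerNoise u w p} := by
    intro w hw
    rw [Set.mem_ofPred_eq, lt_abs] at hw
    rcases hw with hw | hw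
    · exact Or.inl hw.le
    · right
      rw [Set.mem_ofPred_eq, Finset.sum_neg_distrib]
      exact hw.le
  have := (measureReal_mono hsub).trans (measureReal_union_le (μ := answersLaw n m u) _ _)
  linarith

end AnswersLaw

/-! ### Combining graph and answers. -/

section Exam

variable {n m d : ℕ}

/-- The pairs (student, assigned question) involving a given subject. -/
def incidentPairs (G : Assignment n m) : Subject n m → Finset (Fin n × Fin m)
  | Sum.inl i => {i} ×ˢ G i
  | Sum.inr j => (univ.filter fun i => j ∈ G i) ×ˢ {j}

lemma residual_inl_inl (G : Assignment n m) (w : Answers n m) (u : Subject n m → ℝ)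
    (i i' : Fin n) : residual (resultMatrix G w) u (Sum.inl i) (Sum.inl i') = 0 := by
  change (0 : ℝ) - (0 + 0) * _ = 0
  ring

lemma residual_inr_inr (G : Assignment n m) (w : Answers n m) (u : Subject n m → ℝ)
    (j j' : Fin m) : residual (resultMatrix G w) u (Sum.inr j) (Sum.inr j') = 0 := by
  change (0 : ℝ) - (0 + 0) * _ = 0
  ring

lemma residual_inl_inr (G : Assignment n m) (w : Answers n m) (u : Subject n m → ℝ) (i : Fin n)
    (j : Fin m) : residual (resultMatrix G w) u (Sum.inl i) (Sum.inr j) =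
      if j ∈ G i then answerNoise u w (i, j) else 0 := by
  change resultMatrix G w (Sum.inl i) (Sum.inr j) -
    resultWeight G w (Sum.inl i) (Sum.inr j) * _ = _
  rw [resultWeight_inl_inr, answerNoise]
  by_cases h1 : j ∈ G i <;> simp [resultMatrix, h1]

lemma residual_inr_inl (G : Assignment n m) (w : Answers n m) (u : Subject n m → ℝ) (i : Fin n)
    (j : Fin m) : residual (resultMatrix G w) u (Sum.inr j) (Sum.inl i) =
      -if j ∈ G i then answerNoise u w (i, j) else 0 := by
  rw [← residual_inl_inr]
  exact residual_swap _ _ _ _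

lemma abs_sum_residual (G : Assignment n m) (w : Answers n m) (u : Subject n m → ℝ)
    (a : Subject n m) : |∑ b, residual (resultMatrix G w) u a b| =
      |∑ p ∈ incidentPairs G a, answerNoise u w p| := by
  rcases a with i | j
  · rw [Fintype.sum_sum_type]
    simp [residual_inl_inl, residual_inl_inr, incidentPairs]
  · rw [Fintype.sum_sum_type, ← abs_neg]
    simp [residual_inr_inr, residual_inr_inl, incidentPairs, Finset.sum_filter]

lemma sum_resultWeight (G : Assignment n m) (w : Answers n m) (a : Subject n m) :
    ∑ b, resultWeight G w a b = (incidentPairs G a).card := by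
  rcases a with i | j <;> rw [Fintype.sum_sum_type] <;>
    simp [resultWeight_inl_inl, resultWeight_inl_inr, resultWeight_inr_inl, resultWeight_inr_inr,
      incidentPairs]

variable {D L : ℝ}

lemma IsExpander.card_incidentPairs_ge {G : Assignment n m} (h : IsExpander G d D L)
    (hD : 0 ≤ D) (hDd : D ≤ d) (a : Subject n m) :
    D / 2 ≤ (incidentPairs G a).card := by
  rcases a with i | j
  · simp only [incidentPairs, card_product, card_singleton, one_mul, h.card]
    exact (half_le_self hD).trans hDd
  · refine (h.deg_ge j).trans (le_of_eq ?_)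
    simp only [incidentPairs, edgeCount, card_inter_eq_sum, sum_singleton]
    simp

/-- Hoeffding at each subject has exponent `2 η ^ 2` times its degree, and every degree is at least
`D / 2`. -/
lemma prob_noise_le {G : Assignment n m} (h : IsExpander G d D L) (u : Subject n m → ℝ)
    (hD : 0 ≤ D) (hDd : D ≤ d) {η : ℝ} (hη : 0 ≤ η) :
    (answersLaw n m u).real {w | ¬∀ a, |∑ b, residual (resultMatrix G w) u a b| ≤
      η * ∑ b, resultWeight G w a b} ≤ (n + m) * (2 * Real.exp (-(η ^ 2 * D))) := by
  have hset : {w | ¬∀ a, |∑ b, residual (resultMatrix G w) u a b| ≤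
      η * ∑ b, resultWeight G w a b} = ⋃ a, {w | η * (incidentPairs G a).card <
        |∑ p ∈ incidentPairs G a, answerNoise u w p|} := by
    ext w
    simp only [abs_sum_residual, sum_resultWeight, not_forall, not_le, Set.mem_ofPred_eq,
      Set.mem_iUnion]
  rw [hset]
  refine (measureReal_iUnion_fintype_le _).trans ?_
  refine (Finset.sum_le_sum (g := fun _ => 2 * Real.exp (-(η ^ 2 * D))) fun a _ => ?_).trans ?_
  · refine (prob_sum_answerNoise_gt_le u (incidentPairs G a) hη).trans ?_
    have := h.card_incidentPairs_ge hD hDd a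
    have h2 : η ^ 2 * (D / 2) ≤ η ^ 2 * (incidentPairs G a).card := by gcongr
    refine mul_le_mul_of_nonneg_left (Real.exp_le_exp.2 ?_) zero_le_two
    linarith
  · simp

lemma measureReal_prod_le_of_section_le {Ω Ω' : Type*} [MeasurableSpace Ω] [MeasurableSpace Ω']
    (μ : Measure Ω) (ν : Measure Ω') [IsProbabilityMeasure μ] [IsProbabilityMeasure ν]
    {s : Set (Ω × Ω')} (hs : MeasurableSet s) {b : ℝ} (hb : 0 ≤ b)
    (h : ∀ x, ν.real (Prod.mk x ⁻¹' s) ≤ b) : (μ.prod ν).real s ≤ b := by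
  refine ENNReal.toReal_le_of_le_ofReal hb ?_
  rw [Measure.prod_apply hs]
  calc ∫⁻ x, ν (Prod.mk x ⁻¹' s) ∂μ ≤ ∫⁻ _, ENNReal.ofReal b ∂μ :=
        lintegral_mono fun x =>
          (ENNReal.le_ofReal_iff_toReal_le (measure_ne_top _ _) hb).2 (h x)
    _ = ENNReal.ofReal b := by simp

/-- The exam graph expands and the answers are balanced at every subject, with high probability. -/
theorem prob_expander_and_noise_ge (hm : 0 < m) (hd : d ≤ m) (hD : D * m = n * d)
    (hDL : 400 * L ≤ D) (hDd : D ≤ d) (hL : 2 ≤ L) (hLe : Real.exp L = n + m)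
    (u : Subject n m → ℝ) {η : ℝ} (hη : 0 ≤ η) (hηD : η ^ 2 * D = 4 * L) :
    1 - 2 * ((n + m : ℝ) ^ 2)⁻¹ ≤ (examLaw n m d u).real
      {ω | IsExpander ω.1 d D L ∧ ∀ a, |∑ b, residual (resultMatrix ω.1 ω.2) u a b| ≤
        η * ∑ b, resultWeight ω.1 ω.2 a b} := by
  have := isProbabilityMeasure_assignmentLaw (n := n) hd
  have : IsProbabilityMeasure (examLaw n m d u) := by unfold examLaw; infer_instance
  have hD0 : 0 ≤ D := by linarith
  set E : Set (Assignment n m × Answers n m) := {ω | IsExpander ω.1 d D L ∧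
    ∀ a, |∑ b, residual (resultMatrix ω.1 ω.2) u a b| ≤ η * ∑ b, resultWeight ω.1 ω.2 a b} with hE
  let E1 : Set (Assignment n m × Answers n m) := {G | ¬IsExpander G d D L} ×ˢ Set.univ
  let E2 : Set (Assignment n m × Answers n m) := {ω | IsExpander ω.1 d D L ∧
    ¬∀ a, |∑ b, residual (resultMatrix ω.1 ω.2) u a b| ≤ η * ∑ b, resultWeight ω.1 ω.2 a b}
  have hcov : Set.univ ⊆ E ∪ (E1 ∪ E2) := by
    intro ω _
    by_cases h1 : IsExpander ω.1 d D L
    · by_cases h2 : ∀ a, |∑ b, residual (resultMatrix ω.1 ω.2) u a b| ≤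
          η * ∑ b, resultWeight ω.1 ω.2 a b
      · exact Or.inl ⟨h1, h2⟩
      · exact Or.inr (Or.inr ⟨h1, h2⟩)
    · exact Or.inr (Or.inl ⟨h1, Set.mem_univ _⟩)
  have h0 : (examLaw n m d u).real Set.univ ≤ _ := measureReal_mono hcov
  rw [probReal_univ] at h0
  have h1 := measureReal_union_le (μ := examLaw n m d u) E (E1 ∪ E2)
  have h2 := measureReal_union_le (μ := examLaw n m d u) E1 E2
  have hE1 : (examLaw n m d u).real E1 ≤ 8 * Real.exp (-(4 * L)) := by
    unfold examLaw
    rw [measureReal_prod_prod, probReal_univ, mul_one]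
    exact prob_not_isExpander_le hm hd hD hDL hDd (by linarith) hLe
  have hE2 : (examLaw n m d u).real E2 ≤ (n + m) * (2 * Real.exp (-(4 * L))) := by
    unfold examLaw
    refine measureReal_prod_le_of_section_le _ _ (Set.toFinite _).measurableSet (by positivity)
      fun G => ?_
    by_cases hG : IsExpander G d D L
    · have := prob_noise_le hG u hD0 hDd hη
      rw [hηD] at this
      refine (measureReal_mono ?_).trans this
      exact fun w hw => hw.2
    · have : Prod.mk G ⁻¹' E2 = ∅ := by
        ext w
        simp only [E2, Set.mem_preimage, Set.mem_ofPred_eq, hG, false_and, Set.mem_empty_iff_false]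
      rw [this, measureReal_empty]
      positivity
  have hx : Real.exp (-L) = (n + m : ℝ)⁻¹ := by rw [Real.exp_neg, hLe]
  have hpos : (0 : ℝ) < n + m := hLe ▸ Real.exp_pos L
  have h4 : Real.exp (-(4 * L)) = ((n + m : ℝ)⁻¹) ^ 4 := by
    rw [← hx, ← Real.exp_nat_mul]; congr 1; push_cast; ring
  have hxm : (n + m : ℝ)⁻¹ ≤ 1 / 3 := by
    rw [← hLe, ← one_div]
    refine one_div_le_one_div_of_le (by norm_num) ?_
    linarith [Real.add_one_le_exp L]
  rw [h4] at hE1 hE2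
  set x := (n + m : ℝ)⁻¹ with hxdef
  have hx0 : 0 < x := inv_pos.2 hpos
  have hE2' : (n + m : ℝ) * (2 * x ^ 4) = 2 * x ^ 3 := by
    rw [hxdef]; field_simp
  rw [hE2'] at hE2
  rw [← inv_pow, ← hxdef]
  -- The graph fails with probability at most `8 x ^ 4` and the noise bound with at most `2 x ^ 3`,
  -- where `x ≤ 1 / 3`.
  have h5 : 8 * x ^ 4 + 2 * x ^ 3 ≤ 2 * x ^ 2 := by
    have : 8 * x ^ 2 + 2 * x ≤ 2 := by nlinarith
    nlinarith [mul_le_mul_of_nonneg_left this (sq_nonneg x)]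
  linarith

lemma abs_sub_le_of_meritSpread_le {u : Subject n m → ℝ} {A : ℝ} (h : meritSpread u ≤ A)
    (a b : Subject n m) : |u a - u b| ≤ A := by
  have hle : ∀ a b, u a - u b ≤ A := fun a b =>
    (le_ciSup (f := fun p : Subject n m × Subject n m => u p.1 - u p.2)
      (Set.finite_range _).bddAbove (a, b)).trans h
  exact abs_le.2 ⟨by linarith [hle b a], hle a b⟩

/-- The error bound on the event that the graph expands and the answers are balanced. -/
theorem mle_of_expander_and_noise {G : Assignment n m} {w : Answers n m} (h : IsExpander G d D L)
    (hn : 0 < n) (hnm : n ≤ m) (hL : 0 < L) (hDL : 40 * L ≤ D) (hD : D * m = n * d) (hDd : D ≤ d)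
    {T : ℕ} (hT : 2 * (n : ℝ) < (D / (240 * L)) ^ T) {A η : ℝ} {r : Subject n m}
    {u : Subject n m → ℝ} (hur : u r = 0) (hu : meritSpread u ≤ A) (hη0 : 0 < η)
    (hη1 : 500 * η ≤ Real.sigmoid (-(A + 1)) ^ 2)
    (hη : ∀ a, |∑ b, residual (resultMatrix G w) u a b| ≤ η * ∑ b, resultWeight G w a b) :
    (∃! v, IsMLE G w r v) ∧ ∀ v, IsMLE G w r v →
      ‖v - u‖ ≤ 2 * (T + 2 : ℕ) * (500 * η / Real.sigmoid (-(A + 1)) ^ 2) := by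
  set κ := Real.sigmoid (-(A + 1)) ^ 2 with hκ
  have hκ0 : 0 < κ := pow_pos (Real.sigmoid_pos _) 2
  have hs0 : 0 ≤ 500 * η / κ := by positivity
  have hs1 : 500 * η / κ ≤ 1 := (div_le_one hκ0).2 hη1
  have hκs : κ * (500 * η / κ) = 500 * η := by field_simp
  -- The step `s = 500 η / κ` is chosen so that one step moves the sigmoid by at least `500 η`,
  -- matching the thickness `1 / 500`.
  refine exists_unique_maximiser_and_bound (B := resultMatrix G w) (κ := 500 * η) (ε := 1 / 500)
    ?_ hur hs0 (by positivity) (by linarith) hη ?_ ?_ ?_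
  · rintro (i | j) (i' | j') <;> simp only [resultMatrix] <;> try split_ifs <;> simp
    all_goals simp
  · intro a b
    refine hκs.symm.le.trans ?_
    exact sigmoid_add_sub_ge (abs_sub_le_of_meritSpread_le hu a b) hs0 hs1
  · intro a b
    have h1 := (abs_le.1 (abs_sub_le_of_meritSpread_le hu a b)).1
    have h2 : Real.sigmoid (-(A + 1)) ≤ Real.sigmoid (u a - u b) := Real.sigmoid_le (by linarith)
    have h3 : κ ≤ Real.sigmoid (-(A + 1)) := by
      rw [hκ]
      nlinarith [Real.sigmoid_pos (-(A + 1)), Real.sigmoid_lt_one (-(A + 1))]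
    linarith
  · intro S S' hS hS'
    exact h.thickChains_meet (w := w) hn hnm hL hDL hD hDd hT hS hS'

end Exam

/-! ### Choice of parameters and conclusion. -/

/-- The number of steps needed to reach most students. -/
lemma exists_steps {n : ℕ} {D L : ℝ} (hn : 2 ≤ n) (hL : 0 < L) (hD1 : 1 < D) (hDn : D ≤ n)
    (hDL : 57600 * L ^ 2 ≤ D) : ∃ T : ℕ, 2 * (n : ℝ) < (D / (240 * L)) ^ T ∧
      ((T + 2 : ℕ) : ℝ) ≤ 7 * (Real.log n / Real.log D) := by
  have hn' : (2 : ℝ) ≤ n := by exact_mod_cast hn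
  have hlD : 0 < Real.log D := Real.log_pos hD1
  have hlDn : Real.log D ≤ Real.log n := Real.log_le_log (by linarith) hDn
  -- `57600 = 240 ^ 2`, so the growth factor is at least `√D` and its logarithm is comparable to
  -- `log D`.
  have hsq : Real.sqrt D ≤ D / (240 * L) := by
    rw [le_div_iff₀ (by positivity)]
    have h1 : 240 * L ≤ Real.sqrt D := Real.le_sqrt_of_sq_le (by nlinarith)
    nlinarith [Real.mul_self_sqrt (by linarith : (0 : ℝ) ≤ D), Real.sqrt_nonneg D]
  have hlsq : Real.log (Real.sqrt D) = Real.log D / 2 := Real.log_sqrt (by linarith)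
  have hq : 0 ≤ 4 * (Real.log n / Real.log D) := by positivity
  have hq1 : 1 ≤ Real.log n / Real.log D := (one_le_div hlD).2 hlDn
  -- With this `T`, `√D ^ T > n ^ 2 ≥ 2 n`. The extra `3` in `T + 2` is absorbed by `log n / log D ≥
  -- 1`, giving `7 = 4 + 3`.
  refine ⟨⌊4 * (Real.log n / Real.log D)⌋₊ + 1, ?_, ?_⟩
  · have hT := Nat.lt_floor_add_one (4 * (Real.log n / Real.log D))
    refine lt_of_lt_of_le ?_ (pow_le_pow_left₀ (Real.sqrt_nonneg D) hsq _)
    have hsp : 0 < Real.sqrt D := Real.sqrt_pos.2 (by linarith)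
    rw [← Real.log_lt_log_iff (by positivity) (by positivity), Real.log_pow, hlsq,
      Real.log_mul (by norm_num) (by positivity)]
    have h2 : Real.log 2 ≤ Real.log n := Real.log_le_log (by norm_num) hn'
    have h3 : 4 * (Real.log n / Real.log D) * (Real.log D / 2) = 2 * Real.log n := by
      field_simp
      norm_num [mul_comm]
    push_cast
    have := mul_lt_mul_of_pos_right hT (half_pos hlD)
    linarith
  · have hT := Nat.floor_le hq
    push_cast
    linarith

end RandomExam

end

theorem mainTheorem3 (A c : ℝ) (hc : 0 < c) :
    ∃ (C : ℝ) (N : ℕ), ∀ (n m d : ℕ), N ≤ n → n ≤ m → d ≤ m →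
      c * (m * Real.log (n + m) ^ 3 / n) ≤ d →
      ∀ (r : RandomExam.Subject n m) (u : RandomExam.Subject n m → ℝ),
        u r = 0 → RandomExam.meritSpread u ≤ A →
        1 - 2 * ((n + m : ℝ) ^ 2)⁻¹ ≤
          (RandomExam.examLaw n m d u).real
            {ω | (∃! v, RandomExam.IsMLE ω.1 ω.2 r v) ∧
              ∀ v, RandomExam.IsMLE ω.1 ω.2 r v →
                ‖v - u‖ ≤ C * (Real.log n / Real.log (n / m * d) *
                  Real.sqrt (m * Real.log (n + m) / (n * d)))} := by
  set κ : ℝ := Real.sigmoid (-(A + 1)) ^ 2 with hκ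
  have hκ0 : 0 < κ := pow_pos (Real.sigmoid_pos _) 2
  -- A lower bound for `L`: the second term gives `c L ≥ 57600`, the third makes the noise small
  -- against `κ`.
  set Λ : ℝ := 2 + 57600 / c + 1000000 / κ ^ 2 with hΛ
  -- `14000 = 2 * 7 * 500 * 2`: oscillation, number of steps, thickness, and `η = 2 q`.
  refine ⟨14000 / κ, ⌈Real.exp Λ⌉₊ + 2, fun n m d hN hnm hd hcd r u hur hu => ?_⟩
  have hn2 : 2 ≤ n := by omega
  have hn0 : (0 : ℝ) < n := by exact_mod_cast (by omega : 0 < n)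
  have hm : 0 < m := by omega
  have hm0 : (0 : ℝ) < m := by exact_mod_cast hm
  have hnm' : (n : ℝ) ≤ m := by exact_mod_cast hnm
  have hdm' : (d : ℝ) ≤ m := by exact_mod_cast hd
  set L := Real.log (n + m) with hLdef
  set D : ℝ := n / m * d with hDdef
  have hLe : Real.exp L = n + m := Real.exp_log (by positivity)
  have hΛL : Λ ≤ L := by
    rw [hLdef, Real.le_log_iff_exp_le (by positivity)]
    have h1 : Real.exp Λ ≤ n := (Nat.le_ceil _).trans (by exact_mod_cast (by omega))
    linarith
  have h57 : 0 < 57600 / c := by positivity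
  have h1000 : 0 < 1000000 / κ ^ 2 := by positivity
  have hL2 : 2 ≤ L := by linarith
  have hL0 : 0 < L := by linarith
  have hcL : 57600 ≤ c * L := by
    have : 57600 / c ≤ L := by linarith
    rw [div_le_iff₀ hc] at this
    linarith
  have hκL : 1000000 ≤ L * κ ^ 2 := (div_le_iff₀ (by positivity)).1 (by linarith)
  have hDm : D * m = n * d := by rw [hDdef]; field_simp
  have hDc : c * L ^ 3 ≤ D := by
    have h1 : n / m * (c * (m * L ^ 3 / n)) ≤ n / m * d := by gcongr
    rw [hDdef]
    refine le_trans (le_of_eq ?_) h1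
    field_simp
  -- The cube of the logarithm is used here: one factor `L` absorbs `57600 / c`, and `L ^ 2`
  -- remains.
  have hDL2 : 57600 * L ^ 2 ≤ D := by nlinarith [sq_nonneg L]
  have hDL : 400 * L ≤ D := by nlinarith
  have hD1 : 1 < D := by linarith
  have hD0 : 0 < D := by linarith
  have hDd : D ≤ d := by
    rw [hDdef, div_mul_eq_mul_div, div_le_iff₀ hm0]
    nlinarith [Nat.cast_nonneg (α := ℝ) d]
  have hDn : D ≤ n := by
    rw [hDdef, div_mul_eq_mul_div, div_le_iff₀ hm0]
    nlinarith
  set q := Real.sqrt (m * L / (n * d)) with hq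
  have hqD : q ^ 2 * D = L := by
    have hd0 : (0 : ℝ) < d := hD0.trans_le hDd
    rw [hq, Real.sq_sqrt (by positivity), hDdef]
    field_simp
  have hq0 : 0 < q := by
    rcases (Real.sqrt_nonneg (m * L / (n * d))).lt_or_eq with h | h
    · exact h
    · rw [hq, ← h] at hqD
      norm_num at hqD
      linarith
  have hqκ : 500 * (2 * q) ≤ κ := by
    refine le_of_sq_le_sq ?_ hκ0.le
    refine le_of_mul_le_mul_right ?_ hD0
    calc (500 * (2 * q)) ^ 2 * D = 1000000 * (q ^ 2 * D) := by ring
      _ = 1000000 * L := by rw [hqD]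
      _ ≤ κ ^ 2 * (57600 * L ^ 2) := by nlinarith
      _ ≤ κ ^ 2 * D := by gcongr
  obtain ⟨T, hT, hT'⟩ := RandomExam.exists_steps hn2 hL0 hD1 hDn hDL2
  -- `η = 2 q` gives `η ^ 2 * D = 4 L`, so each subject fails with probability at most `2 (n + m) ^
  -- (-4)`.
  have hprob := RandomExam.prob_expander_and_noise_ge hm hd hDm hDL hDd hL2 hLe u
    (η := 2 * q) (by positivity) (by rw [mul_pow, mul_assoc, hqD]; norm_num)
  have := RandomExam.isProbabilityMeasure_assignmentLaw (n := n) hd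
  have : MeasureTheory.IsProbabilityMeasure (RandomExam.examLaw n m d u) := by
    unfold RandomExam.examLaw; infer_instance
  refine hprob.trans (MeasureTheory.measureReal_mono ?_)
  rintro ⟨G, w⟩ ⟨hG, hnoise⟩
  have hmain := RandomExam.mle_of_expander_and_noise hG (by omega) hnm hL0 (by linarith) hDm hDd
    hT hur hu (by positivity) hqκ hnoise
  refine ⟨hmain.1, fun v hv => (hmain.2 v hv).trans ?_⟩
  calc 2 * ((T + 2 : ℕ) : ℝ) * (500 * (2 * q) / κ)
      ≤ 2 * (7 * (Real.log n / Real.log D)) * (500 * (2 * q) / κ) := by gcongr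
    _ = _ := by ring
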